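/- Let $\nu$ be a non-atomic $\sigma$-finite positive measure on $\mathbb R$ with $\int |u|^j\,\nu(du)<\infty$ for $j=2,3,4,6$ and $\int u^2\,\nu(du)=1$. Let $N$ be a Poisson random measure on $\mathbb R\times\mathbb R$, defined on a probability space $(\Omega,\mathcal F,\mathbb P)$, with control (intensity) measure $\mu(du,dx)=\nu(du)\,dx$, let $\hat N=N-\mu$ be the compensated measure, and for $h\in L^2(\mu)$ let $I_1(h)=\int h\,d\hat N$ be the Wiener–Itô integral, i.e. the $L^2(\mathbb P)$-limit of the integrals of simple functions converging to $h$ in $L^2(\mu)$. For $\lambda>0$ the stationary Ornstein–Uhlenbeck Lévy process with parameter $\lambda$ is $$Y_t^{\lambda}=\sqrt{2\lambda}\int_{-\infty}^t\int_{\mathbb R}u\,e^{-\lambda(t-x)}\,\hat N(du,dx)=I_1(f_t^\lambda),\qquad f_t^\lambda(u,x)=\sqrt{2\lambda}\,\mathbf 1_{(-\infty,t]}(x)\,u\,e^{-\lambda(t-x)},\qquad t\ge 0;$$ it has a version which is jointly measurable in $(t,\omega)$, and such a version is taken. For $T>0$ put $A(T,\lambda)=T^{-1/2}\int_0^T Y_t^{\lambda}\,dt$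 (the integral exists almost surely, and $A(T,\lambda)$ is square integrable). For random vectors $X,Y$ in $\mathbb R^d$ with finite second moments let $$d_3(X,Y)=\sup_g\bigl|\mathbb E[g(X)]-\mathbb E[g(Y)]\bigr|,$$ where $g$ runs over all $C^3$ functions $\mathbb R^d\to\mathbb R$ all of whose partial derivatives of orders $2$ and $3$ are bounded by $1$ in absolute value. Theorem. Let $\lambda_1,\dots,\lambda_d>0$. As $T\to\infty$, $$\bar A(T)=(A(T,\lambda_1),\dots,A(T,\lambda_d))\longrightarrow X_B\quad\text{in law},$$ where $X_B$ is a centred $d$-dimensional Gaussian vector with covariance matrix $B=(B_{ij})$, $B_{ij}=2/\sqrt{\lambda_i\lambda_j}$. Moreover, there is a constant $0<\alpha<\infty$, depending only on $\lambda_1,\dots,\lambda_d$ and $\nu$, such that for every $T>0$ $$d_3(\bar A(T),X_B)\le\frac{\alpha}{\sqrt T}.$$ -/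

import Mathlib

open MeasureTheory ProbabilityTheory Filter Topology
open scoped ENNReal NNReal

/-- A Poisson measure on `Z` with control `μ`, defined on the probability space `(Ω, P)`:
a random measure `N` such that `N(B)` has the Poisson law of parameter `μ(B)` whenever
`μ(B) < ∞`, and such that the counts of finitely many pairwise disjoint sets of finite
`μ`-measure are independent. -/
structure IsPoissonRandomMeasure {Ω Z : Type*} [MeasurableSpace Ω] [MeasurableSpace Z]
    (N : Ω → Measure Z) (μ : Measure Z) (P : Measure Ω) : Prop where
  measurable : Measurable N
  hasLaw : ∀ B : Set Z, MeasurableSet B → μ B ≠ ∞ →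
    HasLaw (fun ω => N ω B)
      ((poissonMeasure (μ B).toNNReal).map (fun n : ℕ => (n : ℝ≥0∞))) P
  indep : ∀ (n : ℕ) (B : Fin n → Set Z), (∀ i, MeasurableSet (B i)) → (∀ i, μ (B i) ≠ ∞) →
    Pairwise (fun i j => Disjoint (B i) (B j)) → iIndepFun (fun i ω => N ω (B i)) P

/-- The compensated measure `N̂(B) = N(B) - μ(B)` of a set `B` with `μ(B) < ∞`. -/
noncomputable def compensated {Ω Z : Type*} [MeasurableSpace Z]
    (N : Ω → Measure Z) (μ : Measure Z) (B : Set Z) (ω : Ω) : ℝ :=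
  (N ω).real B - μ.real B

/-- The integral `∑ y, y * N̂(s = y)` of a simple function `s` with respect to the compensated
measure. The value `y = 0` contributes nothing. -/
noncomputable def simpleIntegral {Ω Z : Type*} [MeasurableSpace Z]
    (N : Ω → Measure Z) (μ : Measure Z) (s : SimpleFunc Z ℝ) (ω : Ω) : ℝ :=
  ∑ y ∈ s.range, y * compensated N μ (s ⁻¹' {y}) ω

/-- `F` is (a version of) the Wiener-Itô integral `I₁(h) = ∫ h dN̂` of `h ∈ L²(μ)`: it is the limit
in `L²(P)` of the integrals of simple functions in `L²(μ)` that converge to `h` in `L²(μ)`.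
(A simple function in `L²(μ)` is nonzero only on a set of finite measure.) -/
def IsWienerItoIntegral {Ω Z : Type*} [MeasurableSpace Ω] [MeasurableSpace Z]
    (N : Ω → Measure Z) (μ : Measure Z) (P : Measure Ω) (h : Z → ℝ) (F : Ω → ℝ) : Prop :=
  MemLp h 2 μ ∧ MemLp F 2 P ∧ ∃ s : ℕ → SimpleFunc Z ℝ,
    (∀ n, MemLp (s n) 2 μ) ∧
    Tendsto (fun n => eLpNorm (fun z => s n z - h z) 2 μ) atTop (𝓝 0) ∧
    Tendsto (fun n => eLpNorm (fun ω => simpleIntegral N μ (s n) ω - F ω) 2 P) atTop (𝓝 0)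

/-- The kernel `f_t^l (u, x) = √(2l) 1_{(-∞, t]}(x) u exp(-l (t - x))`. -/
noncomputable def ouKernel (l t : ℝ) (z : ℝ × ℝ) : ℝ :=
  Real.sqrt (2 * l) * (Set.Iic t).indicator (fun _ => (1 : ℝ)) z.2 * z.1 *
    Real.exp (-l * (t - z.2))

/-- `Y` is (a measurable version of) the stationary Ornstein-Uhlenbeck Lévy process of parameter
`l` driven by the compensated Poisson measure on `ℝ × ℝ` with control `ν(du) dx`: the process is
jointly measurable in `(t, ω)`, and `Y t = I₁(f_t^l)` almost surely, for every `t ≥ 0`.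
(Values at negative times play no role.) -/
structure IsOULevyProcess {Ω : Type*} [MeasurableSpace Ω]
    (N : Ω → Measure (ℝ × ℝ)) (ν : Measure ℝ) (P : Measure Ω) (l : ℝ) (Y : ℝ → Ω → ℝ) :
    Prop where
  measurable : Measurable (Function.uncurry Y)
  isIntegral : ∀ t : ℝ, 0 ≤ t →
    IsWienerItoIntegral N (ν.prod volume) P (ouKernel l t) (Y t)

/-- The vector `Ā(T)` of the empirical means `T^{-1/2} ∫_0^T Y^i_t dt`. -/
noncomputable def empiricalMean {Ω : Type*} {d : ℕ} (Y : Fin d → ℝ → Ω → ℝ) (T : ℝ) (ω : Ω) :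
    EuclideanSpace ℝ (Fin d) :=
  WithLp.toLp 2 (fun i => (1 / Real.sqrt T) * ∫ t in (0 : ℝ)..T, Y i t ω)

/-- `‖g^{(k)}‖_∞`, the largest supremum of the absolute value of a partial derivative of order `k`
of `g`. -/
noncomputable def derivSupNorm {d : ℕ} (k : ℕ) (g : EuclideanSpace ℝ (Fin d) → ℝ) : ℝ≥0∞ :=
  ⨆ (i : Fin k → Fin d) (x : EuclideanSpace ℝ (Fin d)),
    ‖iteratedFDeriv ℝ k g x (fun j => EuclideanSpace.single (i j) (1 : ℝ))‖ₑ

/-- The distance `d₃` between two probability laws on `ℝ^d` with finite second moments: the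
supremum of `|E g(X) - E g(Y)|` over `g` of class `C³` with `‖g''‖_∞ ≤ 1` and `‖g'''‖_∞ ≤ 1`. -/
noncomputable def dist3 {d : ℕ} (P Q : Measure (EuclideanSpace ℝ (Fin d))) : ℝ≥0∞ :=
  ⨆ (g : EuclideanSpace ℝ (Fin d) → ℝ) (_ : ContDiff ℝ 3 g)
    (_ : derivSupNorm 2 g ≤ 1) (_ : derivSupNorm 3 g ≤ 1),
    ENNReal.ofReal |(∫ x, g x ∂P) - ∫ x, g x ∂Q|

/-- The covariance matrix `B i j = 2 / √(l_i l_j)`. -/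
noncomputable def limitCov {d : ℕ} (l : Fin d → ℝ) : Matrix (Fin d) (Fin d) ℝ :=
  Matrix.of fun i j => 2 / Real.sqrt (l i * l j)

/-! The averaged process is a single Wiener–Itô integral: exchanging `I₁` with the time integral
turns `A(T, l i)` into `I₁` of the averaged kernel `T^{-1/2} (√(2 l i) / l i) u k_i(x)`, where `k_i
= meanKernel (l i) T` takes values in `[0, 1]` and differs from the indicator of `(0, T]` by two
exponential tails of integral `1 / l i`. Hence the covariance is `B i j` times `T⁻¹ ∫ k_i k_j = 1 +
O(1/T)`, and the integral of the cubed norm of the kernel vector is at most a constant times `T ·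
T^{-3/2} = T^{-1/2}`. This is the source of the rate (`integral_averagedKernel_mul`,
`integral_averagedKernel_cube_le`).

What remains is a Gaussian approximation bound for a vector `I₁(H)`: up to constants, the distance
to `N(0, B)` is at most the covariance error plus `∫ ‖H‖³` (`testDistLE_of_wienerIto`). It comes
from infinite divisibility, by a Lindeberg argument. Test functions have second order Taylor
expansions with uniform bounds, and this property is translation invariant, so errors add under
convolution (`TestDistLE.conv`). Split a compensated Poisson law and the Gaussian law with the same
covariance into `2^n` equal convolution factors. The moments of order one and two match in each
factor, and the third absolute moments are `O(2^{-n})` for Poisson and `O(2^{-3n/2})` for Gauss.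
Summing the `2^n` errors and letting `n → ∞` leaves only the Poisson jump contribution `m |y|³`
(`testDistLE_of_dyadic`, `testDistLE_compensatedPoisson`). The same splitting compares two Gaussian
laws and leaves only the difference of their covariances.

For a simple kernel, `I₁` is a finite sum of independent compensated Poisson vectors; a general
kernel follows by approximation, since `I₁` is a contraction on `L²`. The test class contains the
functions of `d₃` and also rescaled cosines, so one estimate yields both the rate and, through
characteristic functions, the convergence in law. -/

/-! ### Test functions: Taylor expansion and growth. -/

/-- `g` has, at every point, a second order Taylor expansion with second order coefficients at
most `1` and remainder at most `(∑ |v i|)³ / 6`, and its increments grow at most linearly. -/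
structure IsTestFunction {d : ℕ} (g : EuclideanSpace ℝ (Fin d) → ℝ) : Prop where
  taylor : ∀ x, ∃ (L : EuclideanSpace ℝ (Fin d) →L[ℝ] ℝ) (A : Fin d → Fin d → ℝ),
    (∀ i j, |A i j| ≤ 1) ∧
    ∀ v, |g (x + v) - g x - L v - (∑ i, ∑ j, A i j * (v i * v j)) / 2| ≤ (∑ i, |v i|) ^ 3 / 6
  growth : ∃ C : ℝ, 0 ≤ C ∧ ∀ x y, |g x - g y| ≤ C * (1 + ‖x‖ + ‖y‖) * ‖x - y‖

theorem abs_taylor_two_remainder_le {φ : ℝ → ℝ} (hφ : ContDiff ℝ 3 φ) {M : ℝ}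
    (hM : ∀ t, |iteratedDeriv 3 φ t| ≤ M) :
    |φ 1 - φ 0 - iteratedDeriv 1 φ 0 - iteratedDeriv 2 φ 0 / 2| ≤ M / 6 := by
  obtain ⟨t, -, ht⟩ := taylor_mean_remainder_lagrange_iteratedDeriv (f := φ) (x₀ := 0) (x := 1)
    (n := 2) zero_ne_one (by exact_mod_cast hφ.contDiffOn)
  have key : taylorWithinEval φ 2 (Set.uIcc 0 1) 0 1
      = φ 0 + iteratedDeriv 1 φ 0 + iteratedDeriv 2 φ 0 / 2 := by
    rw [taylor_within_apply]
    have h (k : ℕ) (hk : k ≤ 3) :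
        iteratedDerivWithin k φ (Set.uIcc 0 1) 0 = iteratedDeriv k φ 0 := by
      refine iteratedDerivWithin_eq_iteratedDeriv ?_ ?_ (by simp)
      · rw [Set.uIcc_of_le zero_le_one]; exact uniqueDiffOn_Icc zero_lt_one
      · exact (hφ.of_le (by exact_mod_cast hk)).contDiffAt
    simp only [Finset.sum_range_succ, Finset.sum_range_zero, h 0 (by norm_num),
      h 1 (by norm_num), h 2 (by norm_num), iteratedDeriv_zero]
    norm_num [Nat.factorial]
    ring
  rw [key] at ht
  have h3 := hM t
  have : φ 1 - φ 0 - iteratedDeriv 1 φ 0 - iteratedDeriv 2 φ 0 / 2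
      = iteratedDeriv 3 φ t / 6 := by
    rw [iteratedDeriv_one]
    norm_num [Nat.factorial] at ht
    linarith
  rw [this, abs_div]
  norm_num
  linarith

theorem iteratedDeriv_comp_line {E : Type*} [NormedAddCommGroup E] [NormedSpace ℝ E] {g : E → ℝ}
    {n : ℕ} (hg : ContDiff ℝ n g) (x v : E) (k : ℕ) (hk : k ≤ n) (t : ℝ) :
    iteratedDeriv k (fun s : ℝ => g (x + s • v)) t
      = iteratedFDeriv ℝ k g (x + t • v) (fun _ => v) := by
  have h1 : ContDiff ℝ n (fun y => g (x + y)) := hg.comp (by fun_prop)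
  have h2 := (ContinuousLinearMap.toSpanSingleton ℝ v).iteratedFDeriv_comp_right h1 t
    (i := k) (by exact_mod_cast hk)
  rw [iteratedDeriv_eq_iteratedFDeriv]
  have h3 : (fun s : ℝ => g (x + s • v))
      = (fun y => g (x + y)) ∘ (ContinuousLinearMap.toSpanSingleton ℝ v) := by
    ext s; simp
  rw [h3, h2, iteratedFDeriv_comp_add_left]
  simp

theorem EuclideanSpace.eq_sum_smul_single {d : ℕ} (v : EuclideanSpace ℝ (Fin d)) :
    v = ∑ i, v i • EuclideanSpace.single i (1 : ℝ) := by
  ext j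
  simp [Finset.sum_apply, Pi.single_apply]

/-- Expanding each argument in the standard basis gives coefficients whose absolute values sum to a
`k`-th power. This is why Taylor remainders are measured in the `ℓ¹` norm `∑ |v i|`. -/
theorem abs_multilinear_diag_le {d k : ℕ} (m : ContinuousMultilinearMap ℝ
    (fun _ : Fin k => EuclideanSpace ℝ (Fin d)) ℝ)
    (hm : ∀ i : Fin k → Fin d, |m (fun j => EuclideanSpace.single (i j) (1 : ℝ))| ≤ 1)
    (v : EuclideanSpace ℝ (Fin d)) : |m (fun _ => v)| ≤ (∑ i, |v i|) ^ k := by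
  have h : m (fun _ => v) = ∑ r : Fin k → Fin d,
      (∏ j, v (r j)) * m (fun j => EuclideanSpace.single (r j) (1 : ℝ)) := by
    conv_lhs => rw [EuclideanSpace.eq_sum_smul_single v]
    rw [m.map_sum (fun _ i => v i • EuclideanSpace.single i (1 : ℝ))]
    refine Finset.sum_congr rfl fun r _ => ?_
    rw [m.map_smul_univ (fun j => v (r j)) (fun j => EuclideanSpace.single (r j) (1 : ℝ))]
    rfl
  rw [h, Fintype.sum_pow]
  refine (Finset.abs_sum_le_sum_abs _ _).trans (Finset.sum_le_sum fun r _ => ?_)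
  rw [abs_mul, Finset.abs_prod]
  exact mul_le_of_le_one_right (Finset.prod_nonneg fun _ _ => abs_nonneg _) (hm r)

theorem sum_abs_le_card_mul_norm {d : ℕ} (v : EuclideanSpace ℝ (Fin d)) :
    ∑ i, |v i| ≤ d * ‖v‖ := by
  calc ∑ i, |v i| ≤ ∑ _i : Fin d, ‖v‖ :=
        Finset.sum_le_sum fun i _ => by simpa using PiLp.norm_apply_le v i
    _ = d * ‖v‖ := by simp

theorem bilinear_apply_eq_sum {d : ℕ}
    (B : EuclideanSpace ℝ (Fin d) →L[ℝ] EuclideanSpace ℝ (Fin d) →L[ℝ] ℝ)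
    (v w : EuclideanSpace ℝ (Fin d)) :
    B v w = ∑ i, ∑ j, B (EuclideanSpace.single i 1) (EuclideanSpace.single j 1)
      * (v i * w j) := by
  conv_lhs => rw [EuclideanSpace.eq_sum_smul_single v, EuclideanSpace.eq_sum_smul_single w]
  simp only [map_sum, map_smul, sum_apply, smul_apply,
    smul_eq_mul, Finset.mul_sum]
  rw [Finset.sum_comm]
  refine Finset.sum_congr rfl fun i _ => Finset.sum_congr rfl fun j _ => by ring

theorem opNorm_bilinear_le {d : ℕ}
    (B : EuclideanSpace ℝ (Fin d) →L[ℝ] EuclideanSpace ℝ (Fin d) →L[ℝ] ℝ)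
    (hB : ∀ i j, |B (EuclideanSpace.single i 1) (EuclideanSpace.single j 1)| ≤ 1) :
    ‖B‖ ≤ d * d := by
  refine B.opNorm_le_bound (by positivity) fun v => ?_
  refine (B v).opNorm_le_bound (by positivity) fun w => ?_
  rw [bilinear_apply_eq_sum, Real.norm_eq_abs]
  calc |∑ i, ∑ j, B (EuclideanSpace.single i 1) (EuclideanSpace.single j 1) * (v i * w j)|
      ≤ ∑ i, ∑ j, |v i| * |w j| := by
        refine (Finset.abs_sum_le_sum_abs _ _).trans (Finset.sum_le_sum fun i _ => ?_)
        refine (Finset.abs_sum_le_sum_abs _ _).trans (Finset.sum_le_sum fun j _ => ?_)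
        rw [abs_mul, abs_mul]
        exact mul_le_of_le_one_left (by positivity) (hB i j)
    _ = (∑ i, |v i|) * (∑ j, |w j|) := by rw [Finset.sum_mul_sum]
    _ ≤ (d * ‖v‖) * (d * ‖w‖) := mul_le_mul (sum_abs_le_card_mul_norm v)
        (sum_abs_le_card_mul_norm w) (Finset.sum_nonneg fun _ _ => abs_nonneg _) (by positivity)
    _ = d * d * ‖v‖ * ‖w‖ := by ring

theorem abs_partial_le_of_derivSupNorm_le {d k : ℕ} {g : EuclideanSpace ℝ (Fin d) → ℝ}
    (h : derivSupNorm k g ≤ 1) (i : Fin k → Fin d) (x : EuclideanSpace ℝ (Fin d)) :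
    |iteratedFDeriv ℝ k g x (fun j => EuclideanSpace.single (i j) (1 : ℝ))| ≤ 1 := by
  have h1 : ‖iteratedFDeriv ℝ k g x (fun j => EuclideanSpace.single (i j) (1 : ℝ))‖ₑ ≤ 1 :=
    (le_iSup₂ (f := fun (i : Fin k → Fin d) (x : EuclideanSpace ℝ (Fin d)) =>
      ‖iteratedFDeriv ℝ k g x (fun j => EuclideanSpace.single (i j) (1 : ℝ))‖ₑ) i x).trans h
  have h2 : ENNReal.ofReal
      |iteratedFDeriv ℝ k g x (fun j => EuclideanSpace.single (i j) (1 : ℝ))| ≤ 1 := by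
    rwa [← Real.enorm_eq_ofReal_abs]
  simpa using h2

/-- Restriction to a line reduces the Taylor bound to one variable. For the growth, bounded second
partials make the gradient Lipschitz with constant `d²`, so the gradient grows at most linearly. -/
theorem isTestFunction_of_derivSupNorm_le {d : ℕ} {g : EuclideanSpace ℝ (Fin d) → ℝ}
    (hg : ContDiff ℝ 3 g) (h2 : derivSupNorm 2 g ≤ 1) (h3 : derivSupNorm 3 g ≤ 1) :
    IsTestFunction g := by
  have hB (x : EuclideanSpace ℝ (Fin d)) (i j : Fin d) : |fderiv ℝ (fderiv ℝ g) x
      (EuclideanSpace.single i 1) (EuclideanSpace.single j 1)| ≤ 1 := by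
    have := abs_partial_le_of_derivSupNorm_le h2 ![i, j] x
    rw [iteratedFDeriv_two_apply] at this
    simpa using this
  constructor
  · intro x
    refine ⟨fderiv ℝ g x, fun i j => fderiv ℝ (fderiv ℝ g) x
      (EuclideanSpace.single i 1) (EuclideanSpace.single j 1), hB x, fun v => ?_⟩
    have hφ : ContDiff ℝ 3 (fun s : ℝ => g (x + s • v)) := hg.comp (by fun_prop)
    have key := abs_taylor_two_remainder_le hφ (M := (∑ i, |v i|) ^ 3) fun t => by
      rw [iteratedDeriv_comp_line (n := 3) hg x v 3 le_rfl]
      exact abs_multilinear_diag_le _ (fun i => abs_partial_le_of_derivSupNorm_le h3 i _) v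
    rw [iteratedDeriv_comp_line (n := 3) hg x v 1 (by norm_num),
      iteratedDeriv_comp_line (n := 3) hg x v 2 (by norm_num)] at key
    rw [iteratedFDeriv_two_apply, iteratedFDeriv_one_apply, bilinear_apply_eq_sum] at key
    simpa using key
  · have hd : Differentiable ℝ (fderiv ℝ g) :=
      (hg.fderiv_right (m := 1) (by norm_num)).differentiable (by norm_num)
    have hlin (x : EuclideanSpace ℝ (Fin d)) :
        ‖fderiv ℝ g x‖ ≤ ‖fderiv ℝ g 0‖ + d * d * ‖x‖ := by
      have := convex_univ.norm_image_sub_le_of_norm_fderiv_le (𝕜 := ℝ) (f := fderiv ℝ g)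
        (C := d * d) (x := 0) (y := x) (fun y _ => hd y)
        (fun y _ => opNorm_bilinear_le _ (hB y)) (Set.mem_univ _) (Set.mem_univ _)
      rw [sub_zero] at this
      linarith [norm_le_norm_add_norm_sub' (fderiv ℝ g x) (fderiv ℝ g 0)]
    refine ⟨‖fderiv ℝ g 0‖ + d * d, by positivity, fun x y => ?_⟩
    -- The ball of radius `‖x‖ + ‖y‖` is convex and contains both points, and on it the linear bound
    -- for the gradient becomes a constant.
    have := (convex_closedBall (0 : EuclideanSpace ℝ (Fin d))
      (‖x‖ + ‖y‖)).norm_image_sub_le_of_norm_fderiv_le (𝕜 := ℝ) (f := g)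
      (C := (‖fderiv ℝ g 0‖ + d * d) * (1 + ‖x‖ + ‖y‖)) (x := y) (y := x)
      (fun z _ => hg.differentiable (by norm_num) z) (fun z hz => ?_) (by simp) (by simp)
    · simpa using this
    · have hz' : ‖z‖ ≤ ‖x‖ + ‖y‖ := by simpa using hz
      refine (hlin z).trans ?_
      have hdd : (d * d : ℝ) * ‖z‖ ≤ d * d * (‖x‖ + ‖y‖) := by gcongr
      nlinarith [norm_nonneg (fderiv ℝ g 0), norm_nonneg x, norm_nonneg y,
        mul_nonneg (norm_nonneg (fderiv ℝ g 0)) (add_nonneg (norm_nonneg x) (norm_nonneg y)),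
        mul_self_nonneg (d : ℝ)]

/-- Translation invariance is what allows one summand of a convolution to be frozen. -/
theorem IsTestFunction.comp_add_left {d : ℕ} {g : EuclideanSpace ℝ (Fin d) → ℝ}
    (hg : IsTestFunction g) (a : EuclideanSpace ℝ (Fin d)) :
    IsTestFunction (fun x => g (a + x)) := by
  constructor
  · intro x
    obtain ⟨L, A, hA, h⟩ := hg.taylor (a + x)
    exact ⟨L, A, hA, fun v => by simpa only [add_assoc] using h v⟩
  · obtain ⟨C, hC, h⟩ := hg.growth
    refine ⟨C * (1 + 2 * ‖a‖), by positivity, fun x y => ?_⟩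
    refine (h (a + x) (a + y)).trans ?_
    rw [add_sub_add_left_eq_sub]
    refine mul_le_mul_of_nonneg_right ?_ (norm_nonneg _)
    rw [mul_assoc]
    refine mul_le_mul_of_nonneg_left ?_ hC
    nlinarith [norm_add_le a x, norm_add_le a y, norm_nonneg a, norm_nonneg x, norm_nonneg y,
      mul_nonneg (norm_nonneg a) (norm_nonneg x), mul_nonneg (norm_nonneg a) (norm_nonneg y)]

theorem IsTestFunction.continuous {d : ℕ} {g : EuclideanSpace ℝ (Fin d) → ℝ}
    (hg : IsTestFunction g) : Continuous g := by
  obtain ⟨C, hC, h⟩ := hg.growth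
  refine continuous_iff_continuousAt.2 fun x => ?_
  have h1 : Continuous fun y => C * (1 + ‖y‖ + ‖x‖) * ‖y - x‖ := by fun_prop
  have h2 : Tendsto (fun y => C * (1 + ‖y‖ + ‖x‖) * ‖y - x‖) (𝓝 x) (𝓝 0) := by
    simpa using h1.tendsto x
  exact tendsto_iff_dist_tendsto_zero.2 (squeeze_zero (fun _ => dist_nonneg) (h · x) h2)

theorem IsTestFunction.integrable_comp {d : ℕ} {g : EuclideanSpace ℝ (Fin d) → ℝ}
    (hg : IsTestFunction g) {Ω : Type*} [MeasurableSpace Ω] {P : Measure Ω} [IsFiniteMeasure P]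
    {X : Ω → EuclideanSpace ℝ (Fin d)} (hX : MemLp X 2 P) : Integrable (fun ω => g (X ω)) P := by
  obtain ⟨C, hC, h⟩ := hg.growth
  have h1 : Integrable (fun ω => |g 0| + C * (‖X ω‖ + ‖X ω‖ ^ 2)) P :=
    (integrable_const _).add (((hX.integrable one_le_two).norm.add
      (hX.integrable_norm_pow two_ne_zero)).const_mul C)
  refine h1.mono' (hg.continuous.comp_aestronglyMeasurable hX.1) (ae_of_all _ fun ω => ?_)
  have := h (X ω) 0
  simp only [norm_zero, add_zero, sub_zero] at this
  rw [Real.norm_eq_abs]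
  have h3 : |g (X ω)| ≤ |g 0| + |g (X ω) - g 0| := by
    linarith [abs_sub_abs_le_abs_sub (g (X ω)) (g 0)]
  nlinarith

theorem IsTestFunction.integrable {d : ℕ} {g : EuclideanSpace ℝ (Fin d) → ℝ}
    (hg : IsTestFunction g) {P : Measure (EuclideanSpace ℝ (Fin d))} [IsFiniteMeasure P]
    (hP : MemLp id 2 P) : Integrable g P :=
  hg.integrable_comp hP

/-! ### Comparison of laws: convolution, dyadic splitting, moments. -/

/-- The expectations of every test function under `P` and `Q` differ by at most `c`. -/
def TestDistLE {d : ℕ} (P Q : Measure (EuclideanSpace ℝ (Fin d))) (c : ℝ) : Prop :=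
  ∀ g, IsTestFunction g → |(∫ x, g x ∂P) - ∫ x, g x ∂Q| ≤ c

theorem TestDistLE.trans {d : ℕ} {P Q ρ : Measure (EuclideanSpace ℝ (Fin d))} {a b : ℝ}
    (h : TestDistLE P Q a) (h' : TestDistLE Q ρ b) : TestDistLE P ρ (a + b) := fun g hg =>
  (abs_sub_le _ _ _).trans (add_le_add (h g hg) (h' g hg))

theorem memLp_id_conv {d : ℕ} {P Q : Measure (EuclideanSpace ℝ (Fin d))}
    [IsProbabilityMeasure P] [IsProbabilityMeasure Q] (hP : MemLp id 2 P) (hQ : MemLp id 2 Q) :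
    MemLp id 2 (P ∗ Q) := by
  rw [Measure.conv, memLp_map_measure_iff (by fun_prop) (by fun_prop)]
  exact (hP.comp_measurePreserving measurePreserving_fst).add
    (hQ.comp_measurePreserving measurePreserving_snd)

/-- Conditionally on the summand of law `ρ`, the test function is a translate and hence again a test
function; integrating over `ρ` does not increase the error. -/
theorem TestDistLE.conv_left {d : ℕ} {P Q ρ : Measure (EuclideanSpace ℝ (Fin d))}
    [IsProbabilityMeasure P] [IsProbabilityMeasure Q] [IsProbabilityMeasure ρ]
    (hP : MemLp id 2 P) (hQ : MemLp id 2 Q) (hR : MemLp id 2 ρ) {a : ℝ}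
    (h : TestDistLE P Q a) : TestDistLE (ρ ∗ P) (ρ ∗ Q) a := fun g hg => by
  have h1 := hg.integrable (memLp_id_conv hR hP)
  have h2 := hg.integrable (memLp_id_conv hR hQ)
  rw [integral_conv h1, integral_conv h2]
  rw [← integral_sub]
  · refine (abs_integral_le_integral_abs).trans ?_
    calc ∫ x, |(∫ y, g (x + y) ∂P) - ∫ y, g (x + y) ∂Q| ∂ρ ≤ ∫ _x, a ∂ρ := by
          refine integral_mono_of_nonneg (ae_of_all _ fun _ => abs_nonneg _)
            (integrable_const _) (ae_of_all _ fun x => h _ (hg.comp_add_left x))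
      _ = a := by simp
  · rw [Measure.conv, integrable_map_measure (by exact hg.continuous.aestronglyMeasurable)
      (by fun_prop)] at h1
    exact h1.integral_prod_left
  · rw [Measure.conv, integrable_map_measure (by exact hg.continuous.aestronglyMeasurable)
      (by fun_prop)] at h2
    exact h2.integral_prod_left

/-- The factors are replaced one at a time, as in Lindeberg's argument. -/
theorem TestDistLE.conv {d : ℕ} {P₁ P₂ Q₁ Q₂ : Measure (EuclideanSpace ℝ (Fin d))}
    [IsProbabilityMeasure P₁] [IsProbabilityMeasure P₂]
    [IsProbabilityMeasure Q₁] [IsProbabilityMeasure Q₂]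
    (hP₁ : MemLp id 2 P₁) (hP₂ : MemLp id 2 P₂) (hQ₁ : MemLp id 2 Q₁) (hQ₂ : MemLp id 2 Q₂)
    {a b : ℝ} (h₁ : TestDistLE P₁ Q₁ a) (h₂ : TestDistLE P₂ Q₂ b) :
    TestDistLE (P₁ ∗ P₂) (Q₁ ∗ Q₂) (a + b) := by
  rw [add_comm a b]
  refine (h₂.conv_left hP₂ hQ₂ hP₁).trans ?_
  rw [Measure.conv_comm P₁, Measure.conv_comm Q₁]
  exact h₁.conv_left hP₁ hQ₁ hQ₂

/-- Each splitting in two doubles the number of errors, so level `n` contributes `2^n * a n` to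
level `0`. The bound holds for every `n` and hence in the limit. -/
theorem testDistLE_of_dyadic {d : ℕ} {P Q : ℕ → Measure (EuclideanSpace ℝ (Fin d))}
    [∀ n, IsProbabilityMeasure (P n)] [∀ n, IsProbabilityMeasure (Q n)]
    (hP : ∀ n, MemLp id 2 (P n)) (hQ : ∀ n, MemLp id 2 (Q n))
    (hPc : ∀ n, P n = P (n + 1) ∗ P (n + 1)) (hQc : ∀ n, Q n = Q (n + 1) ∗ Q (n + 1))
    {a : ℕ → ℝ} {c : ℝ} (h : ∀ n, TestDistLE (P n) (Q n) (a n))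
    (ha : Tendsto (fun n => 2 ^ n * a n) atTop (𝓝 c)) : TestDistLE (P 0) (Q 0) c := by
  have key (n k : ℕ) : TestDistLE (P k) (Q k) (2 ^ n * a (n + k)) := by
    induction n generalizing k with
    | zero => simpa using h k
    | succ n ih =>
      have := (ih (k + 1)).conv (hP _) (hP _) (hQ _) (hQ _) (ih (k + 1))
      rw [← hPc, ← hQc] at this
      convert this using 1
      rw [show n + 1 + k = n + (k + 1) by ring]
      ring
  exact fun g hg => ge_of_tendsto' ha fun n => key n 0 g hg

/-- Taylor's formula at `0` is integrated under both laws. The linear terms vanish by centring, the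
quadratic terms differ by the covariances, and the remainders are bounded by third absolute moments.
-/
theorem testDistLE_of_moments {d : ℕ} {P Q : Measure (EuclideanSpace ℝ (Fin d))}
    [IsProbabilityMeasure P] [IsProbabilityMeasure Q] (hP : MemLp id 3 P) (hQ : MemLp id 3 Q)
    (hP0 : ∫ x, x ∂P = 0) (hQ0 : ∫ x, x ∂Q = 0) :
    TestDistLE P Q ((∑ i, ∑ j, |(∫ x, x i * x j ∂P) - ∫ x, x i * x j ∂Q|) / 2
      + ((∫ x, (∑ i, |x i|) ^ 3 ∂P) + ∫ x, (∑ i, |x i|) ^ 3 ∂Q) / 6) := by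
  intro g hg
  obtain ⟨L, A, hA, hT⟩ := hg.taylor 0
  simp only [zero_add] at hT
  have main (ρ : Measure (EuclideanSpace ℝ (Fin d))) [IsProbabilityMeasure ρ]
      (hR : MemLp id 3 ρ) (hR0 : ∫ x, x ∂ρ = 0) :
      |(∫ x, g x ∂ρ) - (g 0 + (∑ i, ∑ j, A i j * ∫ x, x i * x j ∂ρ) / 2)|
        ≤ (∫ x, (∑ i, |x i|) ^ 3 ∂ρ) / 6 := by
    have h2 : MemLp id 2 ρ := hR.mono_exponent (by norm_num)
    have hc (i : Fin d) (p : ℝ≥0∞) (h : MemLp id p ρ) : MemLp (fun x => x i) p ρ :=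
      ((EuclideanSpace.proj i : EuclideanSpace ℝ (Fin d) →L[ℝ] ℝ).comp_memLp' h)
    have hij (i j : Fin d) : Integrable (fun x => x i * x j) ρ :=
      (hc i 2 h2).integrable_mul (hc j 2 h2)
    have hL : Integrable (fun x => L x) ρ := L.integrable_comp (h2.integrable one_le_two)
    have hq : Integrable (fun x => (∑ i, ∑ j, A i j * (x i * x j)) / 2) ρ :=
      (integrable_finsetSum _ fun i _ => integrable_finsetSum _ fun j _ =>
        (hij i j).const_mul _).div_const 2
    have h3 : Integrable (fun x => (∑ i, |x i|) ^ 3) ρ := by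
      have : MemLp (fun x : EuclideanSpace ℝ (Fin d) => ∑ i, |x i|) 3 ρ :=
        memLp_finsetSum _ fun i _ => (hc i 3 hR).abs
      refine (this.integrable_norm_pow three_ne_zero).congr (ae_of_all _ fun x => ?_)
      simp [abs_of_nonneg (Finset.sum_nonneg fun i _ => abs_nonneg (x i))]
    have hgi := hg.integrable h2
    have e : (∫ x, g x ∂ρ) - (g 0 + (∑ i, ∑ j, A i j * ∫ x, x i * x j ∂ρ) / 2)
        = ∫ x, (g x - g 0 - L x - (∑ i, ∑ j, A i j * (x i * x j)) / 2) ∂ρ := by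
      have i1 : Integrable (fun x => g x - g 0) ρ := hgi.sub (integrable_const _)
      have i2 : Integrable (fun x => g x - g 0 - L x) ρ := i1.sub hL
      rw [integral_sub i2 hq, integral_sub i1 hL, integral_sub hgi (integrable_const _),
        L.integral_comp_comm (φ := fun x => x) (h2.integrable one_le_two), hR0,
        integral_div, integral_finsetSum _ fun i _ => integrable_finsetSum _ fun j _ =>
          (hij i j).const_mul _]
      simp_rw [integral_finsetSum _ fun j _ => (hij _ j).const_mul _, integral_const_mul]
      simp
      ring
    rw [e, ← integral_div]
    exact abs_integral_le_integral_abs.trans (integral_mono_of_nonneg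
      (ae_of_all _ fun _ => abs_nonneg _) (h3.div_const 6) (ae_of_all _ hT))
  have h1 := main P hP hP0
  have h2 := main Q hQ hQ0
  have h3 : |(∑ i, ∑ j, A i j * ∫ x, x i * x j ∂P) - ∑ i, ∑ j, A i j * ∫ x, x i * x j ∂Q|
      ≤ ∑ i, ∑ j, |(∫ x, x i * x j ∂P) - ∫ x, x i * x j ∂Q| := by
    simp_rw [← Finset.sum_sub_distrib, ← mul_sub]
    refine (Finset.abs_sum_le_sum_abs _ _).trans (Finset.sum_le_sum fun i _ => ?_)
    refine (Finset.abs_sum_le_sum_abs _ _).trans (Finset.sum_le_sum fun j _ => ?_)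
    rw [abs_mul]
    exact mul_le_of_le_one_left (abs_nonneg _) (hA i j)
  rw [abs_le] at *
  constructor <;> linarith

/-! ### Moments of the Poisson law. -/

/-- Factorial moments are the convenient ones: the first `k` terms vanish, and after the index shift
by `k` the factor `r ^ k` comes out of the Poisson weights. -/
theorem hasSum_descFactorial_poisson (r : ℝ≥0) (k : ℕ) :
    HasSum (fun n : ℕ => Real.exp (-r) * r ^ n / n.factorial * (n.descFactorial k : ℝ))
      ((r : ℝ) ^ k) := by
  have h0 : ∑ n ∈ Finset.range k,
      Real.exp (-r) * r ^ n / n.factorial * (n.descFactorial k : ℝ) = 0 :=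
    Finset.sum_eq_zero fun n hn => by
      rw [Nat.descFactorial_eq_zero_iff_lt.2 (Finset.mem_range.1 hn)]; simp
  have h := (hasSum_one_poissonMeasure r).mul_left ((r : ℝ) ^ k)
  rw [mul_one] at h
  rw [← add_zero ((r : ℝ) ^ k), ← h0, ← hasSum_nat_add_iff k]
  refine h.congr_fun fun n => ?_
  have h1 : ((n + k).factorial : ℝ) = n.factorial * (n + k).descFactorial k := by
    have := Nat.factorial_mul_descFactorial (Nat.le_add_left k n)
    rw [Nat.add_sub_cancel] at this
    exact_mod_cast this.symm
  have h2 : ((n + k).descFactorial k : ℝ) ≠ 0 := by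
    have := Nat.descFactorial_eq_zero_iff_lt.not.2 (not_lt.2 (Nat.le_add_left k n))
    exact_mod_cast this
  have h3 : (n.factorial : ℝ) ≠ 0 := by exact_mod_cast n.factorial_ne_zero
  rw [h1, pow_add]
  field_simp

theorem integrable_descFactorial_poisson (r : ℝ≥0) (k : ℕ) :
    Integrable (fun n : ℕ => (n.descFactorial k : ℝ)) (poissonMeasure r) := by
  rw [integrable_poissonMeasure_iff]
  simpa using (hasSum_descFactorial_poisson r k).summable

theorem integral_descFactorial_poisson (r : ℝ≥0) (k : ℕ) :
    ∫ n : ℕ, (n.descFactorial k : ℝ) ∂(poissonMeasure r) = (r : ℝ) ^ k := by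
  rw [integral_poissonMeasure]
  exact (hasSum_descFactorial_poisson r k).tsum_eq

theorem natCast_pow_two_eq_descFactorial (n : ℕ) :
    (n : ℝ) ^ 2 = n.descFactorial 2 + n.descFactorial 1 := by
  rcases n with _ | n
  · simp
  · simp [Nat.descFactorial_succ]; ring

theorem natCast_pow_three_eq_descFactorial (n : ℕ) :
    (n : ℝ) ^ 3 = n.descFactorial 3 + 3 * n.descFactorial 2 + n.descFactorial 1 := by
  rcases n with _ | _ | n
  · simp
  · simp [Nat.descFactorial_succ]
  · simp [Nat.descFactorial_succ]; ring

theorem memLp_natCast_poisson (r : ℝ≥0) : MemLp (fun n : ℕ => (n : ℝ)) 3 (poissonMeasure r) := by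
  have h : Integrable (fun n : ℕ => (n : ℝ) ^ 3) (poissonMeasure r) := by
    simp_rw [natCast_pow_three_eq_descFactorial]
    exact ((integrable_descFactorial_poisson r 3).add
      ((integrable_descFactorial_poisson r 2).const_mul 3)).add
      (integrable_descFactorial_poisson r 1)
  rw [← integrable_norm_rpow_iff .of_discrete three_ne_zero (by simp)]
  refine h.congr (ae_of_all _ fun n => ?_)
  simp only [ENNReal.toReal_ofNat, Real.norm_natCast]
  norm_cast

theorem integral_natCast_poisson (r : ℝ≥0) : ∫ n : ℕ, (n : ℝ) ∂(poissonMeasure r) = r := by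
  simpa using integral_descFactorial_poisson r 1

theorem integral_sub_sq_poisson (r : ℝ≥0) :
    ∫ n : ℕ, ((n : ℝ) - r) ^ 2 ∂(poissonMeasure r) = r := by
  have h1 := integrable_descFactorial_poisson r 1
  have h2 := integrable_descFactorial_poisson r 2
  have e : ∀ n : ℕ, ((n : ℝ) - r) ^ 2
      = n.descFactorial 2 + ((1 - 2 * r) * n.descFactorial 1 + (r : ℝ) ^ 2) := fun n => by
    have := natCast_pow_two_eq_descFactorial n
    simp only [Nat.descFactorial_one] at *
    linarith
  simp_rw [e]
  have h3 : Integrable (fun n : ℕ => (1 - 2 * (r : ℝ)) * n.descFactorial 1 + (r : ℝ) ^ 2)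
      (poissonMeasure r) := (h1.const_mul _).add (integrable_const _)
  rw [integral_add h2 h3, integral_add (h1.const_mul _) (integrable_const _), integral_const_mul,
    integral_descFactorial_poisson, integral_descFactorial_poisson]
  simp
  ring

/-- From `|n - r|³ ≤ (n + r)³ ≤ 4 (n³ + r³)`. In the dyadic limit only the linear term `4 r`
survives. -/
theorem integral_abs_sub_cube_poisson_le (r : ℝ≥0) :
    ∫ n : ℕ, |(n : ℝ) - r| ^ 3 ∂(poissonMeasure r) ≤ 4 * (2 * r ^ 3 + 3 * r ^ 2 + r) := by
  have h1 := integrable_descFactorial_poisson r 1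
  have h2 := integrable_descFactorial_poisson r 2
  have h3 := integrable_descFactorial_poisson r 3
  have i1 : Integrable (fun n : ℕ => (n.descFactorial 1 : ℝ) + (r : ℝ) ^ 3) (poissonMeasure r) :=
    h1.add (integrable_const _)
  have i2 : Integrable (fun n : ℕ => 3 * (n.descFactorial 2 : ℝ)
      + (n.descFactorial 1 + (r : ℝ) ^ 3)) (poissonMeasure r) := (h2.const_mul 3).add i1
  have hi : Integrable (fun n : ℕ => (n.descFactorial 3 : ℝ)
      + (3 * n.descFactorial 2 + (n.descFactorial 1 + (r : ℝ) ^ 3))) (poissonMeasure r) :=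
    h3.add i2
  calc ∫ n : ℕ, |(n : ℝ) - r| ^ 3 ∂(poissonMeasure r)
      ≤ ∫ n : ℕ, 4 * ((n.descFactorial 3 : ℝ)
        + (3 * n.descFactorial 2 + (n.descFactorial 1 + (r : ℝ) ^ 3))) ∂(poissonMeasure r) := by
        refine integral_mono_of_nonneg (ae_of_all _ fun _ => by positivity)
          (hi.const_mul 4) (ae_of_all _ fun n => ?_)
        have hn := natCast_pow_three_eq_descFactorial n
        have hle : |(n : ℝ) - r| ≤ n + r := by
          rw [abs_le]
          constructor <;> linarith [(Nat.cast_nonneg n : (0 : ℝ) ≤ n), r.coe_nonneg]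
        have hp : |(n : ℝ) - r| ^ 3 ≤ (n + r) ^ 3 := pow_le_pow_left₀ (abs_nonneg _) hle 3
        have hq : ((n : ℝ) + r) ^ 3 ≤ 4 * ((n : ℝ) ^ 3 + (r : ℝ) ^ 3) := by
          have hn0 : (0 : ℝ) ≤ n := Nat.cast_nonneg n
          nlinarith [mul_nonneg (add_nonneg hn0 r.coe_nonneg) (sq_nonneg ((n : ℝ) - r))]
        dsimp only
        linarith
    _ = 4 * (2 * r ^ 3 + 3 * r ^ 2 + r) := by
        rw [integral_const_mul, integral_add h3 i2, integral_add (h2.const_mul 3) i1, integral_add h1 (integrable_const _),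
          integral_const_mul, integral_descFactorial_poisson, integral_descFactorial_poisson,
          integral_descFactorial_poisson]
        simp
        ring

/-! ### Compensated Poisson vectors. -/

/-- The law of `(n - m) • y` for `n` Poisson distributed with parameter `m`. -/
noncomputable def compensatedPoisson {d : ℕ} (y : EuclideanSpace ℝ (Fin d)) (m : ℝ≥0) :
    Measure (EuclideanSpace ℝ (Fin d)) :=
  (poissonMeasure m).map (fun n : ℕ => ((n : ℝ) - m) • y)

instance {d : ℕ} (y : EuclideanSpace ℝ (Fin d)) (m : ℝ≥0) :
    IsProbabilityMeasure (compensatedPoisson y m) :=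
  Measure.isProbabilityMeasure_map .of_discrete

theorem memLp_id_compensatedPoisson {d : ℕ} (y : EuclideanSpace ℝ (Fin d)) (m : ℝ≥0) :
    MemLp id 3 (compensatedPoisson y m) := by
  rw [compensatedPoisson, memLp_map_measure_iff (by fun_prop) .of_discrete]
  exact (ContinuousLinearMap.toSpanSingleton ℝ y).comp_memLp'
    ((memLp_natCast_poisson m).sub (memLp_const (m : ℝ)))

theorem integral_id_compensatedPoisson {d : ℕ} (y : EuclideanSpace ℝ (Fin d)) (m : ℝ≥0) :
    ∫ x, x ∂(compensatedPoisson y m) = 0 := by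
  rw [compensatedPoisson, integral_map .of_discrete (by fun_prop), integral_smul_const,
    integral_sub ((memLp_natCast_poisson m).integrable (by norm_num)) (integrable_const _),
    integral_natCast_poisson]
  simp

theorem integral_mul_compensatedPoisson {d : ℕ} (y : EuclideanSpace ℝ (Fin d)) (m : ℝ≥0)
    (i j : Fin d) : ∫ x, x i * x j ∂(compensatedPoisson y m) = m * (y i * y j) := by
  rw [compensatedPoisson, integral_map .of_discrete (by fun_prop)]
  conv_rhs => rw [← integral_sub_sq_poisson m, ← integral_mul_const]
  refine integral_congr_ae (ae_of_all _ fun n => ?_)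
  simp only [PiLp.smul_apply, smul_eq_mul]
  ring

theorem integral_cube_compensatedPoisson_le {d : ℕ} (y : EuclideanSpace ℝ (Fin d)) (m : ℝ≥0) :
    ∫ x, (∑ i, |x i|) ^ 3 ∂(compensatedPoisson y m)
      ≤ (∑ i, |y i|) ^ 3 * (4 * (2 * m ^ 3 + 3 * m ^ 2 + m)) := by
  rw [compensatedPoisson, integral_map .of_discrete (by fun_prop)]
  refine le_trans (le_of_eq ?_) (mul_le_mul_of_nonneg_left
    (integral_abs_sub_cube_poisson_le m) (by positivity))
  rw [← integral_const_mul]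
  refine integral_congr_ae (ae_of_all _ fun n => ?_)
  simp only [PiLp.smul_apply, smul_eq_mul, abs_mul, ← Finset.mul_sum]
  ring

theorem compensatedPoisson_conv {d : ℕ} (y : EuclideanSpace ℝ (Fin d)) (a b : ℝ≥0) :
    compensatedPoisson y a ∗ compensatedPoisson y b = compensatedPoisson y (a + b) := by
  rw [compensatedPoisson, compensatedPoisson, compensatedPoisson,
    ← poissonMeasure_conv_poissonMeasure, Measure.conv, Measure.conv,
    Measure.map_prod_map _ _ .of_discrete .of_discrete, Measure.map_map (by fun_prop) .of_discrete,
    Measure.map_map .of_discrete .of_discrete]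
  congr 1
  ext1 p
  change ((p.1 : ℝ) - a) • y + ((p.2 : ℝ) - b) • y = (((p.1 + p.2 : ℕ) : ℝ) - (a + b : ℝ≥0)) • y
  rw [← add_smul]
  push_cast
  ring_nf

/-! ### Gaussian vectors: convolution, scaling, moments. -/

theorem multivariateGaussian_conv {d : ℕ} {S₁ S₂ : Matrix (Fin d) (Fin d) ℝ}
    (h₁ : S₁.PosSemidef) (h₂ : S₂.PosSemidef) :
    multivariateGaussian 0 S₁ ∗ multivariateGaussian 0 S₂ = multivariateGaussian 0 (S₁ + S₂) := by
  apply Measure.ext_of_charFun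
  ext t
  rw [charFun_conv, charFun_multivariateGaussian h₁, charFun_multivariateGaussian h₂,
    charFun_multivariateGaussian (h₁.add h₂), ← Complex.exp_add]
  congr 1
  simp [Matrix.add_mulVec, dotProduct_add]
  ring

theorem multivariateGaussian_sq_smul {d : ℕ} {S : Matrix (Fin d) (Fin d) ℝ}
    (h : S.PosSemidef) (c : ℝ) :
    multivariateGaussian 0 (c ^ 2 • S) = (multivariateGaussian 0 S).map (fun x => c • x) := by
  apply Measure.ext_of_charFun
  ext t
  rw [charFun_map_smul, charFun_multivariateGaussian h,
    charFun_multivariateGaussian (h.smul (sq_nonneg c))]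
  congr 1
  simp [Matrix.smul_mulVec, Matrix.mulVec_smul, dotProduct_smul, smul_dotProduct]
  ring

theorem integral_mul_multivariateGaussian {d : ℕ} {S : Matrix (Fin d) (Fin d) ℝ}
    (h : S.PosSemidef) (i j : Fin d) :
    ∫ x, x i * x j ∂(multivariateGaussian 0 S) = S i j := by
  have h2 : MemLp id 2 (multivariateGaussian 0 S) := IsGaussian.memLp_two_id
  have hc (i : Fin d) : MemLp (fun x : EuclideanSpace ℝ (Fin d) => x i) 2
      (multivariateGaussian 0 S) :=
    ((EuclideanSpace.proj i : EuclideanSpace ℝ (Fin d) →L[ℝ] ℝ).comp_memLp' h2)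
  have h0 (i : Fin d) : ∫ x, x i ∂(multivariateGaussian 0 S) = 0 := by
    have := (EuclideanSpace.proj i : EuclideanSpace ℝ (Fin d) →L[ℝ] ℝ).integral_comp_comm
      (φ := fun x => x) (h2.integrable one_le_two)
    rw [integral_id_multivariateGaussian] at this
    simpa using this
  have := covariance_eval_multivariateGaussian (μ := 0) h i j
  rw [covariance_eq_sub (hc i) (hc j), h0, h0] at this
  simpa using this

theorem memLp_id_multivariateGaussian {d : ℕ} (S : Matrix (Fin d) (Fin d) ℝ) (p : ℝ≥0) :
    MemLp id p (multivariateGaussian 0 S) := IsGaussian.memLp_id _ _ (by simp)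

theorem integral_cube_multivariateGaussian_smul {d : ℕ} {S : Matrix (Fin d) (Fin d) ℝ}
    (h : S.PosSemidef) {c : ℝ} (hc : 0 ≤ c) :
    ∫ x, (∑ i, |x i|) ^ 3 ∂(multivariateGaussian 0 (c ^ 2 • S))
      = c ^ 3 * ∫ x, (∑ i, |x i|) ^ 3 ∂(multivariateGaussian 0 S) := by
  rw [multivariateGaussian_sq_smul h, integral_map (by fun_prop) (by fun_prop),
    ← integral_const_mul]
  refine integral_congr_ae (ae_of_all _ fun n => ?_)
  simp only [PiLp.smul_apply, smul_eq_mul, abs_mul, ← Finset.mul_sum, abs_of_nonneg hc]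
  ring

/-! ### Gaussian approximation by dyadic splitting. -/

/-- The standard deviation is scaled by `√(1/2)` at each level: writing the variance factor as a
square makes the scaling of third moments a plain cube. -/
theorem sqrt_half_pow_sq (n : ℕ) : (Real.sqrt (1 / 2) ^ n) ^ 2 = (1 / 2) ^ n := by
  rw [← pow_mul, mul_comm, pow_mul, Real.sq_sqrt (by norm_num)]

theorem two_pow_mul_sqrt_half_pow_sq (n : ℕ) : 2 ^ n * (Real.sqrt (1 / 2) ^ n) ^ 2 = 1 := by
  rw [sqrt_half_pow_sq, ← mul_pow]
  norm_num

theorem tendsto_sqrt_half_pow : Tendsto (fun n : ℕ => Real.sqrt (1 / 2) ^ n) atTop (𝓝 0) := by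
  refine tendsto_pow_atTop_nhds_zero_of_lt_one (Real.sqrt_nonneg _) ?_
  rw [Real.sqrt_lt' one_pos]
  norm_num

theorem multivariateGaussian_dyadic {d : ℕ} {S : Matrix (Fin d) (Fin d) ℝ} (h : S.PosSemidef)
    (n : ℕ) : multivariateGaussian 0 ((Real.sqrt (1 / 2) ^ n) ^ 2 • S)
      = multivariateGaussian 0 ((Real.sqrt (1 / 2) ^ (n + 1)) ^ 2 • S)
        ∗ multivariateGaussian 0 ((Real.sqrt (1 / 2) ^ (n + 1)) ^ 2 • S) := by
  rw [multivariateGaussian_conv (h.smul (sq_nonneg _)) (h.smul (sq_nonneg _)), ← add_smul]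
  congr 2
  rw [sqrt_half_pow_sq, sqrt_half_pow_sq, pow_succ]
  ring

/-- At level `n` the covariance error is scaled by `2^{-n}` and the third moments by `2^{-3n/2}`.
After multiplication by `2^n` the covariance term is unchanged and the other tends to `0`. -/
theorem testDistLE_multivariateGaussian {d : ℕ} {S₁ S₂ : Matrix (Fin d) (Fin d) ℝ}
    (h₁ : S₁.PosSemidef) (h₂ : S₂.PosSemidef) :
    TestDistLE (multivariateGaussian 0 S₁) (multivariateGaussian 0 S₂)
      ((∑ i, ∑ j, |S₁ i j - S₂ i j|) / 2) := by
  set c : ℕ → ℝ := fun n => Real.sqrt (1 / 2) ^ n with hc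
  have hc0 (n : ℕ) : 0 ≤ c n := pow_nonneg (Real.sqrt_nonneg _) n
  set K := (∫ x, (∑ i, |x i|) ^ 3 ∂(multivariateGaussian 0 S₁))
    + ∫ x, (∑ i, |x i|) ^ 3 ∂(multivariateGaussian 0 S₂) with hK
  have := testDistLE_of_dyadic (P := fun n => multivariateGaussian 0 (c n ^ 2 • S₁))
    (Q := fun n => multivariateGaussian 0 (c n ^ 2 • S₂))
    (a := fun n => (c n ^ 2 * ∑ i, ∑ j, |S₁ i j - S₂ i j|) / 2 + (c n ^ 3 * K) / 6)
    (c := (∑ i, ∑ j, |S₁ i j - S₂ i j|) / 2)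
    (fun n => memLp_id_multivariateGaussian _ 2) (fun n => memLp_id_multivariateGaussian _ 2)
    (multivariateGaussian_dyadic h₁) (multivariateGaussian_dyadic h₂) (fun n => ?_) ?_
  · simpa [hc] using this
  · have h := testDistLE_of_moments
      (memLp_id_multivariateGaussian (c n ^ 2 • S₁) 3) (memLp_id_multivariateGaussian _ 3)
      integral_id_multivariateGaussian (integral_id_multivariateGaussian (S := c n ^ 2 • S₂))
    simp only [integral_mul_multivariateGaussian (h₁.smul (sq_nonneg (c n))),
      integral_mul_multivariateGaussian (h₂.smul (sq_nonneg (c n))),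
      integral_cube_multivariateGaussian_smul h₁ (hc0 n),
      integral_cube_multivariateGaussian_smul h₂ (hc0 n), ← mul_add, ← hK, Matrix.smul_apply,
      smul_eq_mul, ← mul_sub, abs_mul, ← Finset.mul_sum, abs_of_nonneg (sq_nonneg (c n))] at h
    exact h
  -- Every term contains `c n ^ 2`, which cancels `2 ^ n`.
  · have e (n : ℕ) : 2 ^ n * ((c n ^ 2 * ∑ i, ∑ j, |S₁ i j - S₂ i j|) / 2 + (c n ^ 3 * K) / 6)
        = (∑ i, ∑ j, |S₁ i j - S₂ i j|) / 2 + c n * (K / 6) := by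
      have h := two_pow_mul_sqrt_half_pow_sq n
      change 2 ^ n * c n ^ 2 = 1 at h
      linear_combination ((∑ i, ∑ j, |S₁ i j - S₂ i j|) / 2 + c n * (K / 6)) * h
    simp_rw [e]
    have hl := (tendsto_sqrt_half_pow.mul_const (K / 6)).const_add
      ((∑ i, ∑ j, |S₁ i j - S₂ i j|) / 2)
    rwa [zero_mul, add_zero] at hl

theorem posSemidef_smul_vecMulVec {d : ℕ} (y : Fin d → ℝ) {m : ℝ} (hm : 0 ≤ m) :
    (m • Matrix.vecMulVec y y).PosSemidef := by
  have := Matrix.posSemidef_vecMulVec_self_star y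
  rw [star_trivial] at this
  exact this.smul hm

/-- The covariances agree exactly at every level, so only third moments count. The constant `2 / 3`
is `4 / 6`: the linear coefficient of the Poisson third moment bound over the `6` of the Taylor
remainder. -/
theorem testDistLE_compensatedPoisson {d : ℕ} (y : EuclideanSpace ℝ (Fin d)) (m : ℝ≥0) :
    TestDistLE (compensatedPoisson y m)
      (multivariateGaussian 0 ((m : ℝ) • Matrix.vecMulVec y y))
      (2 / 3 * (m * (∑ i, |y i|) ^ 3)) := by
  have hS := posSemidef_smul_vecMulVec y m.coe_nonneg
  set S := (m : ℝ) • Matrix.vecMulVec y y with hSdef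
  set c : ℕ → ℝ := fun n => Real.sqrt (1 / 2) ^ n with hc
  have hc0 (n : ℕ) : 0 ≤ c n := pow_nonneg (Real.sqrt_nonneg _) n
  have hcoe (n : ℕ) : ((m * (1 / 2) ^ n : ℝ≥0) : ℝ) = m * c n ^ 2 := by
    rw [sqrt_half_pow_sq]
    push_cast
    rfl
  set K := ∫ x, (∑ i, |x i|) ^ 3 ∂(multivariateGaussian 0 S) with hK
  set s := ∑ i, |y i| with hs
  have := testDistLE_of_dyadic (P := fun n => compensatedPoisson y (m * (1 / 2) ^ n))
    (Q := fun n => multivariateGaussian 0 (c n ^ 2 • S))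
    (a := fun n => (s ^ 3 * (4 * (2 * (m * c n ^ 2) ^ 3 + 3 * (m * c n ^ 2) ^ 2 + m * c n ^ 2))
      + c n ^ 3 * K) / 6)
    (c := 2 / 3 * (m * s ^ 3))
    (fun n => (memLp_id_compensatedPoisson _ _).mono_exponent (by norm_num))
    (fun n => memLp_id_multivariateGaussian _ 2)
    (fun n => ?_) (multivariateGaussian_dyadic hS) (fun n => ?_) ?_
  · simpa [hc] using this
  · rw [compensatedPoisson_conv, ← mul_add, pow_succ, ← mul_add]
    norm_num
  · have h := testDistLE_of_moments
      (memLp_id_compensatedPoisson y (m * (1 / 2) ^ n)) (memLp_id_multivariateGaussian _ 3)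
      (integral_id_compensatedPoisson _ _)
      (integral_id_multivariateGaussian (S := c n ^ 2 • S))
    intro g hg
    refine (h g hg).trans ?_
    have h3 := integral_cube_compensatedPoisson_le y (m * (1 / 2) ^ n)
    have h0 : ∀ i j, (∫ x, x i * x j ∂(compensatedPoisson y (m * (1 / 2) ^ n)))
        - ∫ x, x i * x j ∂(multivariateGaussian 0 (c n ^ 2 • S)) = 0 := fun i j => by
      rw [integral_mul_multivariateGaussian (hS.smul (sq_nonneg (c n))),
        integral_mul_compensatedPoisson, hcoe]
      simp [hSdef, Matrix.vecMulVec_apply]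
      ring
    simp only [h0, integral_cube_multivariateGaussian_smul hS (hc0 n), ← hK]
    rw [hcoe] at h3
    simp only [abs_zero, Finset.sum_const_zero, zero_div, zero_add]
    linarith
  · have e (n : ℕ) : 2 ^ n * ((s ^ 3 * (4 * (2 * (m * c n ^ 2) ^ 3 + 3 * (m * c n ^ 2) ^ 2
        + m * c n ^ 2)) + c n ^ 3 * K) / 6)
        = (s ^ 3 * (4 * (2 * m ^ 3 * c n ^ 4 + 3 * m ^ 2 * c n ^ 2 + m)) + c n * K) / 6 := by
      have h := two_pow_mul_sqrt_half_pow_sq n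
      change 2 ^ n * c n ^ 2 = 1 at h
      linear_combination ((s ^ 3 * (4 * (2 * m ^ 3 * c n ^ 4 + 3 * m ^ 2 * c n ^ 2 + m))
        + c n * K) / 6) * h
    simp_rw [e]
    have hcont : Continuous fun t : ℝ =>
        (s ^ 3 * (4 * (2 * (m : ℝ) ^ 3 * t ^ 4 + 3 * (m : ℝ) ^ 2 * t ^ 2 + m)) + t * K) / 6 := by
      fun_prop
    have hl := (hcont.tendsto 0).comp tendsto_sqrt_half_pow
    have hv : (s ^ 3 * (4 * (2 * (m : ℝ) ^ 3 * 0 ^ 4 + 3 * (m : ℝ) ^ 2 * 0 ^ 2 + m)) + 0 * K) / 6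
        = 2 / 3 * (m * s ^ 3) := by ring
    rwa [hv] at hl

/-- Independence turns the law of the sum into a convolution, and so the errors add up by induction.
-/
theorem testDistLE_sum_of_iIndepFun {d : ℕ} {Ω ι : Type*} [MeasurableSpace Ω] {P : Measure Ω}
    [IsProbabilityMeasure P] {X : ι → Ω → EuclideanSpace ℝ (Fin d)}
    (hX : iIndepFun X P) (hm : ∀ i, Measurable (X i)) (hL : ∀ i, MemLp (X i) 2 P)
    {S : ι → Matrix (Fin d) (Fin d) ℝ} (hS : ∀ i, (S i).PosSemidef) {c : ι → ℝ}
    (h : ∀ i, TestDistLE (P.map (X i)) (multivariateGaussian 0 (S i)) (c i)) (s : Finset ι) :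
    TestDistLE (P.map (∑ i ∈ s, X i)) (multivariateGaussian 0 (∑ i ∈ s, S i))
      (∑ i ∈ s, c i) := by
  classical
  induction s using Finset.induction_on with
  | empty =>
    intro g _
    have e1 : P.map (0 : Ω → EuclideanSpace ℝ (Fin d)) = Measure.dirac 0 := by
      change P.map (fun _ => (0 : EuclideanSpace ℝ (Fin d))) = _
      rw [Measure.map_const]; simp
    have e2 : multivariateGaussian 0 (0 : Matrix (Fin d) (Fin d) ℝ) = Measure.dirac 0 := by
      simp [multivariateGaussian]
    simp [e1, e2]
  | insert a s ha ih =>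
    have hLs : MemLp (∑ i ∈ s, X i) 2 P := memLp_finsetSum' _ fun i _ => hL i
    have hms : Measurable (∑ i ∈ s, X i) := by fun_prop
    have hi : IndepFun (X a) (∑ i ∈ s, X i) P :=
      (hX.indepFun_finsetSum_of_notMem hm ha).symm
    have hprob (Z : Ω → EuclideanSpace ℝ (Fin d)) (hZ : Measurable Z) :
        IsProbabilityMeasure (P.map Z) := Measure.isProbabilityMeasure_map hZ.aemeasurable
    have := hprob _ (hm a)
    have := hprob _ hms
    have hmap (Z : Ω → EuclideanSpace ℝ (Fin d)) (hZ : Measurable Z) (hZ2 : MemLp Z 2 P) :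
        MemLp id 2 (P.map Z) := by
      rw [memLp_map_measure_iff (by fun_prop) hZ.aemeasurable]
      exact hZ2
    rw [Finset.sum_insert ha, Finset.sum_insert ha, Finset.sum_insert ha,
      hi.map_add_eq_map_conv_map (hm a) hms,
      ← multivariateGaussian_conv (hS a) (Matrix.posSemidef_sum s fun i _ => hS i)]
    exact (h a).conv (hmap _ (hm a) (hL a)) (hmap _ hms hLs) (memLp_id_multivariateGaussian _ 2)
      (memLp_id_multivariateGaussian _ 2) ih

/-! ### Moments and independence of the compensated measure. -/

namespace IsPoissonRandomMeasure

variable {Ω Z : Type*} [MeasurableSpace Ω] [MeasurableSpace Z] {N : Ω → Measure Z}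
  {μ : Measure Z} {P : Measure Ω} {B C : Set Z}

theorem measurable_compensated (hN : IsPoissonRandomMeasure N μ P) (hB : MeasurableSet B) :
    Measurable (compensated N μ B) :=
  (((Measure.measurable_coe hB).comp hN.measurable).ennreal_toReal).sub_const _

theorem hasLaw_compensated (hN : IsPoissonRandomMeasure N μ P) (hB : MeasurableSet B)
    (hB' : μ B ≠ ∞) : HasLaw (compensated N μ B)
      ((poissonMeasure (μ B).toNNReal).map (fun n : ℕ => (n : ℝ) - (μ B).toNNReal)) P := by
  refine ⟨(hN.measurable_compensated hB).aemeasurable, ?_⟩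
  have h := (hN.hasLaw B hB hB').map_eq
  have e : compensated N μ B = (fun x : ℝ≥0∞ => x.toReal - μ.real B) ∘ fun ω => N ω B := rfl
  have hm : Measurable fun ω => N ω B := (Measure.measurable_coe hB).comp hN.measurable
  rw [e, ← Measure.map_map (by fun_prop) hm, h, Measure.map_map (by fun_prop) .of_discrete]
  rfl

theorem map_compensated_smul (hN : IsPoissonRandomMeasure N μ P) (hB : MeasurableSet B)
    (hB' : μ B ≠ ∞) {d : ℕ} (y : EuclideanSpace ℝ (Fin d)) :
    P.map (fun ω => compensated N μ B ω • y) = compensatedPoisson y (μ B).toNNReal := by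
  have e : (fun ω => compensated N μ B ω • y) = (fun c : ℝ => c • y) ∘ compensated N μ B := rfl
  rw [e, ← Measure.map_map (by fun_prop) (hN.measurable_compensated hB),
    (hN.hasLaw_compensated hB hB').map_eq, Measure.map_map (by fun_prop) .of_discrete]
  rfl

theorem memLp_compensated (hN : IsPoissonRandomMeasure N μ P) (hB : MeasurableSet B)
    (hB' : μ B ≠ ∞) : MemLp (compensated N μ B) 2 P := by
  have h : MemLp id 2 (P.map (compensated N μ B)) := by
    rw [(hN.hasLaw_compensated hB hB').map_eq, memLp_map_measure_iff (by fun_prop) .of_discrete]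
    exact ((memLp_natCast_poisson _).sub (memLp_const _)).mono_exponent (by norm_num)
  rwa [memLp_map_measure_iff (by fun_prop) (hN.measurable_compensated hB).aemeasurable] at h

theorem integral_compensated (hN : IsPoissonRandomMeasure N μ P) (hB : MeasurableSet B)
    (hB' : μ B ≠ ∞) : ∫ ω, compensated N μ B ω ∂P = 0 := by
  rw [(hN.hasLaw_compensated hB hB').integral_eq, integral_map .of_discrete (by fun_prop),
    integral_sub ((memLp_natCast_poisson _).integrable (by norm_num)) (integrable_const _),
    integral_natCast_poisson]
  simp

theorem integral_compensated_sq (hN : IsPoissonRandomMeasure N μ P) (hB : MeasurableSet B)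
    (hB' : μ B ≠ ∞) : ∫ ω, compensated N μ B ω * compensated N μ B ω ∂P = μ.real B := by
  have := (hN.hasLaw_compensated hB hB').integral_comp (f := fun x => x * x) (by fun_prop)
  refine this.trans ?_
  rw [integral_map .of_discrete (by fun_prop)]
  simp_rw [← sq]
  rw [integral_sub_sq_poisson]
  rfl

/-- `Measure.real` sends an infinite count to `0`, so finiteness must be known almost surely before
`compensated` can be additive. -/
theorem ae_ne_top (hN : IsPoissonRandomMeasure N μ P) (hB : MeasurableSet B)
    (hB' : μ B ≠ ∞) : ∀ᵐ ω ∂P, N ω B ≠ ∞ := by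
  rw [(hN.hasLaw B hB hB').ae_iff (p := fun x => x ≠ ∞)
    (measurableSet_setOfPred.1 (MeasurableSet.singleton (∞ : ℝ≥0∞)).compl),
    ae_map_iff .of_discrete (by exact (MeasurableSet.singleton (∞ : ℝ≥0∞)).compl)]
  exact ae_of_all _ fun n => ENNReal.natCast_ne_top n

theorem compensated_union (hN : IsPoissonRandomMeasure N μ P) (hB : MeasurableSet B)
    (hC : MeasurableSet C) (hB' : μ B ≠ ∞) (hC' : μ C ≠ ∞) (h : Disjoint B C) :
    compensated N μ (B ∪ C) =ᵐ[P] compensated N μ B + compensated N μ C := by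
  filter_upwards [hN.ae_ne_top hB hB', hN.ae_ne_top hC hC'] with ω h1 h2
  simp only [compensated, Pi.add_apply]
  rw [measureReal_union h hC h1 h2, measureReal_union h hC hB' hC']
  ring

theorem iIndepFun_compensated (hN : IsPoissonRandomMeasure N μ P) {ι : Type*} [Fintype ι]
    {D : ι → Set Z} (hD : ∀ i, MeasurableSet (D i)) (hD' : ∀ i, μ (D i) ≠ ∞)
    (h : Pairwise fun i j => Disjoint (D i) (D j)) :
    iIndepFun (fun i => compensated N μ (D i)) P := by
  have h1 := hN.indep _ (D ∘ (Fintype.equivFin ι).symm) (fun i => hD _) (fun i => hD' _)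
    fun i j hij => h ((Fintype.equivFin ι).symm.injective.ne hij)
  have h2 := h1.precomp (Fintype.equivFin ι).injective
  have h3 : iIndepFun (fun i ω => N ω (D i)) P := by simpa using h2
  exact h3.comp (fun i x => x.toReal - μ.real (D i)) fun i => by fun_prop

theorem integral_compensated_mul (hN : IsPoissonRandomMeasure N μ P) (hB : MeasurableSet B)
    (hC : MeasurableSet C) (hB' : μ B ≠ ∞) (hC' : μ C ≠ ∞) (h : Disjoint B C) :
    ∫ ω, compensated N μ B ω * compensated N μ C ω ∂P = 0 := by
  have h1 := hN.iIndepFun_compensated (D := fun b : Bool => if b then B else C)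
    (by rintro (_ | _) <;> assumption) (by rintro (_ | _) <;> assumption)
    (by rintro (_ | _) (_ | _) hij <;> first | exact absurd rfl hij | exact h | exact h.symm)
  have h2 := h1.indepFun (i := true) (j := false) (by simp)
  have h3 := h2.integral_fun_mul_eq_mul_integral (hN.measurable_compensated hB).aestronglyMeasurable
    (hN.measurable_compensated hC).aestronglyMeasurable
  refine h3.trans ?_
  simp [hN.integral_compensated hB hB']

end IsPoissonRandomMeasure

/-! ### The Wiener–Itô integral as a contraction of `L²` spaces. -/

open Classical in
/-- The class in `L²(P)` of the compensated measure of `B` (zero if it is not in `L²(P)`). -/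
noncomputable def compensatedLp {Ω Z : Type*} [MeasurableSpace Ω] [MeasurableSpace Z]
    (N : Ω → Measure Z) (μ : Measure Z) (P : Measure Ω) (B : Set Z) : Lp ℝ 2 P :=
  if h : MemLp (compensated N μ B) 2 P then h.toLp _ else 0

/-- The compensated measure as an operator valued set function. -/
noncomputable def compensatedOp {Ω Z : Type*} [MeasurableSpace Ω] [MeasurableSpace Z]
    (N : Ω → Measure Z) (μ : Measure Z) (P : Measure Ω) (B : Set Z) : ℝ →L[ℝ] Lp ℝ 2 P :=
  ContinuousLinearMap.toSpanSingleton ℝ (compensatedLp N μ P B)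

/-- The square integrable simple functions. -/
def simpleFuncL2 {Z : Type*} [MeasurableSpace Z] (μ : Measure Z) :
    Submodule ℝ (SimpleFunc Z ℝ) where
  carrier := {s | MemLp s 2 μ}
  zero_mem' := MemLp.zero
  add_mem' hs ht := hs.add ht
  smul_mem' c _ hs := hs.const_smul c

/-- The embedding of the square integrable simple functions into `L²`. -/
def simpleFuncL2.toLp {Z : Type*} [MeasurableSpace Z] (μ : Measure Z) :
    simpleFuncL2 μ →ₗ[ℝ] Lp ℝ 2 μ where
  toFun s := MemLp.toLp s.1 s.2
  map_add' _ _ := rfl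
  map_smul' _ _ := rfl

theorem simpleFuncL2.denseRange_toLp {Z : Type*} [MeasurableSpace Z] (μ : Measure Z) :
    DenseRange (simpleFuncL2.toLp μ) := by
  intro f
  refine Metric.mem_closure_iff.2 fun ε hε => ?_
  obtain ⟨s, hs, hs2⟩ := (Lp.memLp f).exists_simpleFunc_eLpNorm_sub_lt (by simp)
    (ENNReal.ofReal_pos.2 hε).ne'
  refine ⟨simpleFuncL2.toLp μ ⟨s, hs2⟩, ⟨_, rfl⟩, ?_⟩
  rw [← Lp.toLp_coeFn f (Lp.memLp f)]
  change dist (MemLp.toLp f (Lp.memLp f)) (MemLp.toLp s hs2) < ε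
  rw [dist_eq_norm, ← MemLp.toLp_sub, Lp.norm_toLp]
  exact (ENNReal.lt_ofReal_iff_toReal_lt hs.ne_top).1 hs

namespace IsPoissonRandomMeasure

variable {Ω Z : Type*} [MeasurableSpace Ω] [MeasurableSpace Z] {N : Ω → Measure Z}
  {μ : Measure Z} {P : Measure Ω} {B C : Set Z}

theorem compensatedLp_eq (hN : IsPoissonRandomMeasure N μ P) (hB : MeasurableSet B)
    (hB' : μ B ≠ ∞) : compensatedLp N μ P B = (hN.memLp_compensated hB hB').toLp _ :=
  dif_pos _

/-- Additivity on sets of finite measure is what makes the integral of simple functions linear,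
whatever their representation. -/
theorem finMeasAdditive_compensatedOp (hN : IsPoissonRandomMeasure N μ P) :
    FinMeasAdditive μ (compensatedOp N μ P) := by
  intro s t hs ht hs' ht' hst
  have hu : μ (s ∪ t) ≠ ∞ := (measure_union_lt_top hs'.lt_top ht'.lt_top).ne
  have : compensatedLp N μ P (s ∪ t) = compensatedLp N μ P s + compensatedLp N μ P t := by
    rw [hN.compensatedLp_eq hs hs', hN.compensatedLp_eq ht ht', hN.compensatedLp_eq (hs.union ht) hu,
      ← MemLp.toLp_add, MemLp.toLp_eq_toLp_iff]
    exact hN.compensated_union hs ht hs' ht' hst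
  ext
  simp [compensatedOp, this]

theorem inner_compensatedLp_self (hN : IsPoissonRandomMeasure N μ P) (hB : MeasurableSet B)
    (hB' : μ B ≠ ∞) : inner ℝ (compensatedLp N μ P B) (compensatedLp N μ P B) = μ.real B := by
  rw [hN.compensatedLp_eq hB hB', L2.inner_def, ← hN.integral_compensated_sq hB hB']
  refine integral_congr_ae ?_
  filter_upwards [(hN.memLp_compensated hB hB').coeFn_toLp] with ω h
  simp [h, sq]

theorem inner_compensatedLp_of_disjoint (hN : IsPoissonRandomMeasure N μ P)
    (hB : MeasurableSet B) (hC : MeasurableSet C) (hB' : μ B ≠ ∞) (hC' : μ C ≠ ∞)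
    (h : Disjoint B C) : inner ℝ (compensatedLp N μ P B) (compensatedLp N μ P C) = 0 := by
  rw [hN.compensatedLp_eq hB hB', hN.compensatedLp_eq hC hC', L2.inner_def,
    ← hN.integral_compensated_mul hB hC hB' hC' h]
  refine integral_congr_ae ?_
  filter_upwards [(hN.memLp_compensated hB hB').coeFn_toLp,
    (hN.memLp_compensated hC hC').coeFn_toLp] with ω h1 h2
  simp [h1, h2, mul_comm]

/-- The level sets of a simple function are disjoint, so their compensated measures are orthogonal
and only the diagonal terms remain. -/
theorem inner_setToSimpleFunc (hN : IsPoissonRandomMeasure N μ P) {s : SimpleFunc Z ℝ}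
    (hs : MemLp s 2 μ) :
    inner ℝ (s.setToSimpleFunc (compensatedOp N μ P)) (s.setToSimpleFunc (compensatedOp N μ P))
      = ∑ y ∈ s.range, μ.real (s ⁻¹' {y}) * y ^ 2 := by
  simp only [SimpleFunc.setToSimpleFunc, sum_inner, inner_sum, compensatedOp,
    ContinuousLinearMap.toSpanSingleton_apply, inner_smul_left, inner_smul_right]
  refine Finset.sum_congr rfl fun y hy => ?_
  -- The zero level set may have infinite measure; its coefficient vanishes, so it is treated apart.
  by_cases h0 : y = 0
  · simp [h0]
  rw [Finset.sum_eq_single_of_mem y hy]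
  · rw [hN.inner_compensatedLp_self (s.measurableSet_fiber y)
      (s.measure_preimage_lt_top_of_memLp two_ne_zero (by simp) hs y h0).ne]
    simp
    ring
  · intro z _ hz
    by_cases h1 : z = 0
    · simp [h1]
    rw [hN.inner_compensatedLp_of_disjoint (s.measurableSet_fiber _)
        (s.measurableSet_fiber _)
        (s.measure_preimage_lt_top_of_memLp two_ne_zero (by simp) hs _ h1).ne
        (s.measure_preimage_lt_top_of_memLp two_ne_zero (by simp) hs _ h0).ne]
    · simp
    · exact Disjoint.preimage _ (by simpa using hz)

theorem norm_setToSimpleFunc (hN : IsPoissonRandomMeasure N μ P) {s : SimpleFunc Z ℝ}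
    (hs : MemLp s 2 μ) :
    ‖s.setToSimpleFunc (compensatedOp N μ P)‖ = ‖hs.toLp s‖ := by
  rw [← sq_eq_sq₀ (norm_nonneg _) (norm_nonneg _), ← real_inner_self_eq_norm_sq,
    ← real_inner_self_eq_norm_sq, hN.inner_setToSimpleFunc hs, L2.inner_def]
  have hi : Integrable s μ := (s.memLp_iff_integrable two_ne_zero (by simp)).1 hs
  have h1 := SimpleFunc.map_integral s (fun x : ℝ => x ^ 2) hi (by simp)
  have h2 := SimpleFunc.integral_eq_integral (s.map (fun x : ℝ => x ^ 2))
    ((SimpleFunc.integrable_iff_finMeasSupp).2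
      ((SimpleFunc.integrable_iff_finMeasSupp.1 hi).map (by simp)))
  rw [h1] at h2
  simp only [smul_eq_mul] at h2
  rw [h2]
  refine integral_congr_ae ?_
  filter_upwards [hs.coeFn_toLp] with z h
  simp [h, sq]

theorem simpleIntegral_ae_eq (hN : IsPoissonRandomMeasure N μ P) {s : SimpleFunc Z ℝ}
    (hs : MemLp s 2 μ) :
    (s.setToSimpleFunc (compensatedOp N μ P) : Lp ℝ 2 P) =ᵐ[P] simpleIntegral N μ s := by
  have h1 : ∀ y ∈ s.range, (compensatedOp N μ P (s ⁻¹' {y}) y : Lp ℝ 2 P) =ᵐ[P]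
      fun ω => y * compensated N μ (s ⁻¹' {y}) ω := by
    intro y _
    by_cases h0 : y = 0
    · subst h0
      filter_upwards [Lp.coeFn_zero ℝ 2 P] with ω h
      simpa using h
    have hfin := (s.measure_preimage_lt_top_of_memLp two_ne_zero (by simp) hs y h0).ne
    rw [compensatedOp, ContinuousLinearMap.toSpanSingleton_apply,
      hN.compensatedLp_eq (s.measurableSet_fiber y) hfin]
    filter_upwards [Lp.coeFn_smul y ((hN.memLp_compensated (s.measurableSet_fiber y) hfin).toLp _),
      (hN.memLp_compensated (s.measurableSet_fiber y) hfin).coeFn_toLp] with ω h1 h2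
    rw [h1, Pi.smul_apply, h2, smul_eq_mul]
  have h2 := (Finset.eventually_all s.range).2 h1
  filter_upwards [Lp.coeFn_fun_finsetSum s.range fun y => compensatedOp N μ P (s ⁻¹' {y}) y, h2]
    with ω h3 h4
  rw [SimpleFunc.setToSimpleFunc, h3, simpleIntegral]
  exact Finset.sum_congr rfl h4

/-- The integral of square integrable simple functions as a linear map. -/
noncomputable def simpleWienerIto (hN : IsPoissonRandomMeasure N μ P) :
    simpleFuncL2 μ →ₗ[ℝ] Lp ℝ 2 P where
  toFun s := s.1.setToSimpleFunc (compensatedOp N μ P)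
  map_add' s t := SimpleFunc.setToSimpleFunc_add _ hN.finMeasAdditive_compensatedOp
    ((s.1.memLp_iff_integrable two_ne_zero (by simp)).1 s.2)
    ((t.1.memLp_iff_integrable two_ne_zero (by simp)).1 t.2)
  map_smul' c s := SimpleFunc.setToSimpleFunc_smul_real _ hN.finMeasAdditive_compensatedOp c
    ((s.1.memLp_iff_integrable two_ne_zero (by simp)).1 s.2)

/-- The Wiener-Itô integral as a continuous linear map from `L²(μ)` to `L²(P)`. -/
noncomputable def wienerIto (hN : IsPoissonRandomMeasure N μ P) : Lp ℝ 2 μ →L[ℝ] Lp ℝ 2 P :=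
  hN.simpleWienerIto.extendOfNorm (simpleFuncL2.toLp μ)

/-- The Itô isometry on simple functions, which lets the integral extend from a dense subspace. -/
theorem norm_simpleWienerIto (hN : IsPoissonRandomMeasure N μ P) (s : simpleFuncL2 μ) :
    ‖hN.simpleWienerIto s‖ = ‖simpleFuncL2.toLp μ s‖ := hN.norm_setToSimpleFunc s.2

theorem wienerIto_toLp (hN : IsPoissonRandomMeasure N μ P) {s : SimpleFunc Z ℝ}
    (hs : MemLp s 2 μ) :
    hN.wienerIto (hs.toLp s) = s.setToSimpleFunc (compensatedOp N μ P) :=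
  LinearMap.extendOfNorm_eq (simpleFuncL2.denseRange_toLp μ)
    ⟨1, fun s => by rw [one_mul, hN.norm_simpleWienerIto]⟩ (⟨s, hs⟩ : simpleFuncL2 μ)

theorem norm_wienerIto_le (hN : IsPoissonRandomMeasure N μ P) (f : Lp ℝ 2 μ) :
    ‖hN.wienerIto f‖ ≤ ‖f‖ := by
  have := LinearMap.norm_extendOfNorm_apply_le (simpleFuncL2.denseRange_toLp μ) 1
    (fun s => by rw [one_mul, hN.norm_simpleWienerIto]) f
  rwa [one_mul] at this

end IsPoissonRandomMeasure

/-! ### Stability of expectations under `L²` convergence. -/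

theorem integral_comp_simpleFunc {Z E : Type*} [MeasurableSpace Z] [NormedAddCommGroup E]
    {μ : Measure Z} {s : SimpleFunc Z E} (hs : MemLp s 2 μ) {g : E → ℝ} (hg : g 0 = 0) :
    ∫ z, g (s z) ∂μ = ∑ y ∈ s.range, μ.real (s ⁻¹' {y}) * g y := by
  have hi : Integrable s μ := (s.memLp_iff_integrable two_ne_zero (by simp)).1 hs
  have h1 := SimpleFunc.map_integral s g hi hg
  have h2 := SimpleFunc.integral_eq_integral (s.map g)
    ((SimpleFunc.integrable_iff_finMeasSupp).2
      ((SimpleFunc.integrable_iff_finMeasSupp.1 hi).map hg))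
  rw [h1] at h2
  exact h2.symm

theorem eLpNorm_le_sum_eLpNorm_eval {α : Type*} [MeasurableSpace α] {μ : Measure α} {d : ℕ}
    {X : α → EuclideanSpace ℝ (Fin d)} (hX : AEStronglyMeasurable X μ) :
    eLpNorm X 2 μ ≤ ∑ i, eLpNorm (fun x => X x i) 2 μ := by
  have hX' (i : Fin d) : AEStronglyMeasurable (fun x => X x i) μ :=
    (EuclideanSpace.proj i : EuclideanSpace ℝ (Fin d) →L[ℝ] ℝ).continuous.comp_aestronglyMeasurable
      hX
  calc eLpNorm X 2 μ
      = eLpNorm (∑ i, fun x => X x i • EuclideanSpace.single i (1 : ℝ)) 2 μ := by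
        congr 1
        ext1 x
        rw [Finset.sum_apply]
        exact EuclideanSpace.eq_sum_smul_single (X x)
    _ ≤ ∑ i, eLpNorm (fun x => X x i • EuclideanSpace.single i (1 : ℝ)) 2 μ :=
        eLpNorm_sum_le (fun i _ => (hX' i).smul_const _) one_le_two
    _ = ∑ i, eLpNorm (fun x => X x i) 2 μ := by
        refine Finset.sum_congr rfl fun i _ => eLpNorm_congr_norm_ae (ae_of_all _ fun x => ?_)
        simp [norm_smul]

theorem eLpNorm_mul_le_eLpNorm_two {Ω : Type*} [MeasurableSpace Ω] {P : Measure Ω} {φ ψ : Ω → ℝ}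
    (hφ : AEStronglyMeasurable φ P) (hψ : AEStronglyMeasurable ψ P) :
    eLpNorm (fun ω => φ ω * ψ ω) 1 P ≤ eLpNorm φ 2 P * eLpNorm ψ 2 P :=
  (eLpNorm_le_eLpNorm_mul_eLpNorm_of_nnnorm (p := 2) (q := 2) (r := 1) hφ hψ (· * ·) 1
    (ae_of_all _ fun ω => by rw [one_mul, nnnorm_mul])).trans (by rw [ENNReal.coe_one, one_mul])

/-- Replacing `‖X‖` by `‖Y‖ + ‖X - Y‖` in the growth bound gives `C (1 + 2‖Y‖) ‖X - Y‖ + C ‖X -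
Y‖²`; the Cauchy–Schwarz inequality handles both terms. -/
theorem eLpNorm_comp_sub_le_of_growth {d : ℕ} {g : EuclideanSpace ℝ (Fin d) → ℝ} {C : ℝ}
    (hC : 0 ≤ C) (hCg : ∀ x y, |g x - g y| ≤ C * (1 + ‖x‖ + ‖y‖) * ‖x - y‖)
    {Ω : Type*} [MeasurableSpace Ω] {P : Measure Ω}
    {X Y : Ω → EuclideanSpace ℝ (Fin d)} (hX : AEStronglyMeasurable X P)
    (hY : AEStronglyMeasurable Y P) :
    eLpNorm ((fun ω => g (X ω)) - fun ω => g (Y ω)) 1 P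
      ≤ eLpNorm (fun ω => C * (1 + 2 * ‖Y ω‖)) 2 P * eLpNorm (X - Y) 2 P
        + ENNReal.ofReal C * eLpNorm (X - Y) 2 P * eLpNorm (X - Y) 2 P := by
  have hA : AEStronglyMeasurable (fun ω => C * (1 + 2 * ‖Y ω‖)) P :=
    (aestronglyMeasurable_const.add (hY.norm.const_mul 2)).const_mul C
  have hD : AEStronglyMeasurable (fun ω => ‖(X - Y) ω‖) P := (hX.sub hY).norm
  have h1 := eLpNorm_mul_le_eLpNorm_two hA hD
  have h2 := eLpNorm_mul_le_eLpNorm_two (hD.const_mul C) hD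
  rw [eLpNorm_norm] at h1
  have e : eLpNorm (fun ω => C * ‖(X - Y) ω‖) 2 P = ENNReal.ofReal C * eLpNorm (X - Y) 2 P := by
    rw [← eLpNorm_norm (X - Y), ← Real.enorm_of_nonneg hC]
    exact eLpNorm_const_smul C _ 2 P
  rw [eLpNorm_norm, e] at h2
  refine le_trans ?_ ((eLpNorm_add_le (hA.mul hD) ((hD.const_mul C).mul hD) le_rfl).trans
    (add_le_add h1 h2))
  refine eLpNorm_mono_real fun ω => (hCg (X ω) (Y ω)).trans ?_
  have h1 : ‖X ω‖ ≤ ‖Y ω‖ + ‖X ω - Y ω‖ := by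
    linarith [norm_sub_norm_le (X ω) (Y ω)]
  simp only [Pi.add_apply, Pi.mul_apply, Pi.sub_apply]
  rw [← add_mul, ← mul_add]
  refine mul_le_mul_of_nonneg_right (mul_le_mul_of_nonneg_left ?_ hC) (norm_nonneg _)
  linarith

theorem IsTestFunction.tendsto_integral_comp {d : ℕ} {g : EuclideanSpace ℝ (Fin d) → ℝ}
    (hg : IsTestFunction g) {Ω : Type*} [MeasurableSpace Ω] {P : Measure Ω} [IsFiniteMeasure P]
    {X : ℕ → Ω → EuclideanSpace ℝ (Fin d)} {Y : Ω → EuclideanSpace ℝ (Fin d)}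
    (hX : ∀ n, MemLp (X n) 2 P) (hY : MemLp Y 2 P)
    (h : Tendsto (fun n => eLpNorm (X n - Y) 2 P) atTop (𝓝 0)) :
    Tendsto (fun n => ∫ ω, g (X n ω) ∂P) atTop (𝓝 (∫ ω, g (Y ω) ∂P)) := by
  obtain ⟨C, hC, hCg⟩ := hg.growth
  refine tendsto_integral_of_L1' _ (hg.integrable_comp hY).1
    (Eventually.of_forall fun n => hg.integrable_comp (hX n)) ?_
  have hA : MemLp (fun ω => C * (1 + 2 * ‖Y ω‖)) 2 P :=
    ((memLp_const (1 : ℝ)).add (hY.norm.const_mul (2 : ℝ))).const_mul C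
  refine tendsto_of_tendsto_of_tendsto_of_le_of_le tendsto_const_nhds ?_ (fun _ => zero_le)
    fun n => eLpNorm_comp_sub_le_of_growth hC hCg (hX n).1 hY.1
  have h1 := ENNReal.Tendsto.const_mul h (Or.inr hA.2.ne)
  have h2 := ENNReal.Tendsto.const_mul h
    (Or.inr (ENNReal.ofReal_ne_top : ENNReal.ofReal C ≠ ∞))
  have h3 := h1.add (ENNReal.Tendsto.mul h2 (Or.inr (by simp)) h (Or.inr (by simp)))
  simpa using h3

/-! ### Gaussian approximation of vector valued Wiener–Itô integrals. -/

namespace IsPoissonRandomMeasure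

variable {Ω Z : Type*} [MeasurableSpace Ω] [MeasurableSpace Z] {N : Ω → Measure Z}
  {μ : Measure Z} {P : Measure Ω}

theorem memLp_simpleIntegral (hN : IsPoissonRandomMeasure N μ P) {s : SimpleFunc Z ℝ}
    (hs : MemLp s 2 μ) : MemLp (simpleIntegral N μ s) 2 P :=
  (Lp.memLp _).ae_eq (hN.simpleIntegral_ae_eq hs)

theorem wienerIto_toLp_eq_toLp (hN : IsPoissonRandomMeasure N μ P) {s : SimpleFunc Z ℝ}
    (hs : MemLp s 2 μ) :
    hN.wienerIto (hs.toLp s) = (hN.memLp_simpleIntegral hs).toLp (simpleIntegral N μ s) := by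
  rw [hN.wienerIto_toLp, ← Lp.toLp_coeFn _ (Lp.memLp (s.setToSimpleFunc (compensatedOp N μ P))),
    MemLp.toLp_eq_toLp_iff]
  exact hN.simpleIntegral_ae_eq hs

/-- One direction is uniqueness of limits in `L²(P)`; the other takes any approximating sequence of
simple functions, which exists by density, and uses continuity of `wienerIto`. -/
theorem isWienerItoIntegral_iff (hN : IsPoissonRandomMeasure N μ P) {h : Z → ℝ} {F : Ω → ℝ}
    (hh : MemLp h 2 μ) (hF : MemLp F 2 P) :
    IsWienerItoIntegral N μ P h F ↔ hN.wienerIto (hh.toLp h) = hF.toLp F := by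
  constructor
  · rintro ⟨-, -, s, hs, h1, h2⟩
    have h3 := (Lp.tendsto_Lp_iff_tendsto_eLpNorm'' (fun n => ⇑(s n)) hs h hh).2 h1
    have h4 := (hN.wienerIto.continuous.tendsto _).comp h3
    have h5 := (Lp.tendsto_Lp_iff_tendsto_eLpNorm'' (fun n => simpleIntegral N μ (s n))
      (fun n => hN.memLp_simpleIntegral (hs n)) F hF).2 h2
    refine tendsto_nhds_unique h4 (h5.congr fun n => ?_)
    exact (hN.wienerIto_toLp_eq_toLp (hs n)).symm
  · intro e
    have hex (n : ℕ) : ∃ s : SimpleFunc Z ℝ, eLpNorm (h - ⇑s) 2 μ < (n + 1 : ℝ≥0∞)⁻¹ ∧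
        MemLp s 2 μ := hh.exists_simpleFunc_eLpNorm_sub_lt (by simp) (by simp)
    choose s hs1 hs using hex
    have h1 : Tendsto (fun n => eLpNorm (⇑(s n) - h) 2 μ) atTop (𝓝 0) := by
      refine tendsto_of_tendsto_of_tendsto_of_le_of_le tendsto_const_nhds
        (g := fun _ => 0) (h := fun n : ℕ => (n + 1 : ℝ≥0∞)⁻¹) ?_ (fun _ => zero_le) fun n => ?_
      · have := ENNReal.tendsto_inv_nat_nhds_zero.comp (tendsto_add_atTop_nat 1)
        refine this.congr fun n => ?_
        simp
      · dsimp only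
        rw [eLpNorm_sub_comm]
        exact (hs1 n).le
    refine ⟨hh, hF, s, hs, h1, ?_⟩
    have h3 := (Lp.tendsto_Lp_iff_tendsto_eLpNorm'' (fun n => ⇑(s n)) hs h hh).2 h1
    have h4 := (hN.wienerIto.continuous.tendsto _).comp h3
    rw [e] at h4
    refine (Lp.tendsto_Lp_iff_tendsto_eLpNorm'' (fun n => simpleIntegral N μ (s n))
      (fun n => hN.memLp_simpleIntegral (hs n)) F hF).1 (h4.congr fun n => ?_)
    exact hN.wienerIto_toLp_eq_toLp (hs n)

/-- The integral of a vector valued simple function. -/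
noncomputable def _root_.vectorSimpleIntegral {d : ℕ} (N : Ω → Measure Z) (μ : Measure Z)
    (S : SimpleFunc Z (EuclideanSpace ℝ (Fin d))) (ω : Ω) : EuclideanSpace ℝ (Fin d) :=
  ∑ y ∈ S.range with y ≠ 0, compensated N μ (S ⁻¹' {y}) ω • y

variable {d : ℕ} {S : SimpleFunc Z (EuclideanSpace ℝ (Fin d))}

theorem memLp_vectorSimpleIntegral (hN : IsPoissonRandomMeasure N μ P) (hS : MemLp S 2 μ) :
    MemLp (vectorSimpleIntegral N μ S) 2 P := by
  refine memLp_finsetSum _ fun y hy => ?_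
  exact (ContinuousLinearMap.toSpanSingleton ℝ y).comp_memLp'
    (hN.memLp_compensated (S.measurableSet_fiber y) (S.measure_preimage_lt_top_of_memLp
      two_ne_zero (by simp) hS y (Finset.mem_filter.1 hy).2).ne)

/-- Level sets of a coordinate of `S` are unions of level sets of `S`. Additivity lets all
coordinates be integrated over the common partition given by `S`, which exhibits the vector as a sum
over disjoint sets. -/
theorem wienerIto_eval (hN : IsPoissonRandomMeasure N μ P) (hS : MemLp S 2 μ) (i : Fin d) :
    hN.wienerIto ((hS.eval_piLp i).toLp _)
      = ((hN.memLp_vectorSimpleIntegral hS).eval_piLp i).toLp _ := by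
  have hi : Integrable S μ := (S.memLp_iff_integrable two_ne_zero (by simp)).1 hS
  have h1 : MemLp (S.map fun y => y i) 2 μ := hS.eval_piLp i
  have h2 := hN.wienerIto_toLp h1
  rw [SimpleFunc.map_setToSimpleFunc _ hN.finMeasAdditive_compensatedOp hi (by simp)] at h2
  refine h2.trans ?_
  have h3 : ∀ y ∈ S.range, y ≠ 0 → (compensatedOp N μ P (S ⁻¹' {y}) (y i) : Lp ℝ 2 P) =ᵐ[P]
      fun ω => compensated N μ (S ⁻¹' {y}) ω * y i := by
    intro y _ h0
    have hfin := (S.measure_preimage_lt_top_of_memLp two_ne_zero (by simp) hS y h0).ne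
    rw [compensatedOp, ContinuousLinearMap.toSpanSingleton_apply,
      hN.compensatedLp_eq (S.measurableSet_fiber y) hfin]
    filter_upwards [Lp.coeFn_smul (y i)
      ((hN.memLp_compensated (S.measurableSet_fiber y) hfin).toLp _),
      (hN.memLp_compensated (S.measurableSet_fiber y) hfin).coeFn_toLp] with ω h1 h2
    rw [h1, Pi.smul_apply, h2, smul_eq_mul, mul_comm]
  have h4 : ∑ y ∈ S.range, (compensatedOp N μ P (S ⁻¹' {y}) (y i) : Lp ℝ 2 P)
      = ∑ y ∈ S.range with y ≠ 0, compensatedOp N μ P (S ⁻¹' {y}) (y i) := by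
    refine (Finset.sum_subset (Finset.filter_subset _ _) fun y hy hy' => ?_).symm
    have : y = 0 := by
      by_contra h0
      exact hy' (Finset.mem_filter.2 ⟨hy, h0⟩)
    simp [this]
  rw [h4]
  have h5 : ∀ y ∈ S.range.filter (fun y => y ≠ 0),
      (compensatedOp N μ P (S ⁻¹' {y}) (y i) : Lp ℝ 2 P) =ᵐ[P]
      fun ω => compensated N μ (S ⁻¹' {y}) ω * y i := fun y hy =>
    h3 y (Finset.mem_filter.1 hy).1 (Finset.mem_filter.1 hy).2
  refine Lp.ext ?_
  filter_upwards [Lp.coeFn_fun_finsetSum (S.range.filter (fun y => y ≠ 0))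
    fun y => compensatedOp N μ P (S ⁻¹' {y}) (y i), (Finset.eventually_all _).2 h5,
    ((hN.memLp_vectorSimpleIntegral hS).eval_piLp i).coeFn_toLp] with ω h6 h7 h8
  rw [h6, h8, vectorSimpleIntegral, Finset.sum_congr rfl h7]
  simp

/-- The compensated counts of the level sets are independent, so the integral is a sum of
independent compensated Poisson vectors. The jump directions are the values `y`, the intensities the
measures of the level sets; summing the errors `m (∑ |y i|)³` rebuilds the integral. -/
theorem testDistLE_vectorSimpleIntegral [IsProbabilityMeasure P]
    (hN : IsPoissonRandomMeasure N μ P) (hS : MemLp S 2 μ) :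
    (Matrix.of fun i j => ∫ z, S z i * S z j ∂μ).PosSemidef ∧
    TestDistLE (P.map (vectorSimpleIntegral N μ S))
      (multivariateGaussian 0 (Matrix.of fun i j => ∫ z, S z i * S z j ∂μ))
      (2 / 3 * ∫ z, (∑ i, |S z i|) ^ 3 ∂μ) := by
  set t := S.range.filter (fun y => y ≠ 0) with ht
  have hfin (y : t) : μ (S ⁻¹' {y.1}) ≠ ∞ := (S.measure_preimage_lt_top_of_memLp two_ne_zero
    (by simp) hS y (Finset.mem_filter.1 y.2).2).ne
  have hsum (g : EuclideanSpace ℝ (Fin d) → ℝ) (hg : g 0 = 0) :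
      ∫ z, g (S z) ∂μ = ∑ y : t, μ.real (S ⁻¹' {y.1}) * g y := by
    rw [integral_comp_simpleFunc hS hg, Finset.sum_coe_sort t (fun y => μ.real (S ⁻¹' {y}) * g y)]
    refine (Finset.sum_subset (Finset.filter_subset _ _) fun y hy hy' => ?_).symm
    have : y = 0 := by
      by_contra h0
      exact hy' (Finset.mem_filter.2 ⟨hy, h0⟩)
    simp [this, hg]
  have hcov : (Matrix.of fun i j => ∫ z, S z i * S z j ∂μ)
      = ∑ y : t, μ.real (S ⁻¹' {y.1}) • Matrix.vecMulVec y.1 y.1 := by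
    ext i j
    rw [Matrix.of_apply, hsum (fun y => y i * y j) (by simp), Matrix.sum_apply]
    rfl
  have hpos (y : t) : (μ.real (S ⁻¹' {y.1}) • Matrix.vecMulVec y.1 y.1).PosSemidef :=
    posSemidef_smul_vecMulVec _ measureReal_nonneg
  have hF : vectorSimpleIntegral N μ S
      = ∑ y : t, fun ω => compensated N μ (S ⁻¹' {y.1}) ω • y.1 := by
    ext1 ω
    rw [vectorSimpleIntegral, Finset.sum_apply,
      Finset.sum_coe_sort t (fun y => compensated N μ (S ⁻¹' {y}) ω • y)]
  rw [hcov, hF, hsum (fun y => (∑ i, |y i|) ^ 3) (by simp), Finset.mul_sum]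
  refine ⟨Matrix.posSemidef_sum _ fun y _ => hpos y, ?_⟩
  have hind := hN.iIndepFun_compensated (D := fun y : t => S ⁻¹' {y.1})
    (fun y => S.measurableSet_fiber _) hfin
    fun y z hyz => Disjoint.preimage _ (Set.disjoint_singleton.2 (Subtype.coe_injective.ne hyz))
  have hind' := hind.comp (fun (y : t) (c : ℝ) => c • y.1) fun y => by fun_prop
  refine testDistLE_sum_of_iIndepFun hind' (fun y => ?_) (fun y => ?_) hpos (fun y => ?_) _
  · exact (hN.measurable_compensated (S.measurableSet_fiber _)).smul_const _
  · exact (ContinuousLinearMap.toSpanSingleton ℝ y.1).comp_memLp'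
      (hN.memLp_compensated (S.measurableSet_fiber y.1) (hfin y))
  · have h1 := hN.map_compensated_smul (S.measurableSet_fiber y.1) (hfin y) y.1
    have h2 := testDistLE_compensatedPoisson y.1 (μ (S ⁻¹' {y.1})).toNNReal
    rw [← h1] at h2
    exact h2

theorem testDistLE_of_wienerIto [IsProbabilityMeasure P] (hN : IsPoissonRandomMeasure N μ P)
    {H : Z → EuclideanSpace ℝ (Fin d)} (hHm : Measurable H) (hH : MemLp H 2 μ)
    (hH3 : Integrable (fun z => ‖H z‖ ^ 3) μ) {F : Ω → EuclideanSpace ℝ (Fin d)}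
    (hF : MemLp F 2 P)
    (hFW : ∀ i, hN.wienerIto ((hH.eval_piLp i).toLp _) = (hF.eval_piLp i).toLp _)
    {B : Matrix (Fin d) (Fin d) ℝ} (hB : B.PosSemidef) :
    TestDistLE (P.map F) (multivariateGaussian 0 B)
      ((∑ i, ∑ j, |(∫ z, H z i * H z j ∂μ) - B i j|) / 2
        + 2 / 3 * ((2 * d) ^ 3 * ∫ z, ‖H z‖ ^ 3 ∂μ)) := by
  intro g hg
  -- Approximation based at `0` gives `‖S n‖ ≤ 2 ‖H‖`. This domination controls the third moments
  -- uniformly in `n`, at the price of the factor `(2 * d) ^ 3`, so their convergence is not needed.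
  set S : ℕ → SimpleFunc Z (EuclideanSpace ℝ (Fin d)) :=
    SimpleFunc.approxOn H hHm Set.univ 0 (Set.mem_univ _) with hSdef
  have hS (n : ℕ) : MemLp (S n) 2 μ :=
    SimpleFunc.memLp_approxOn hHm hH (Set.mem_univ _) MemLp.zero n
  have hSle (n : ℕ) (z : Z) : ‖S n z‖ ≤ 2 * ‖H z‖ := by
    rw [two_mul]
    exact SimpleFunc.norm_approxOn_zero_le hHm (Set.mem_univ _) z n
  have hSt : Tendsto (fun n => eLpNorm (⇑(S n) - H) 2 μ) atTop (𝓝 0) :=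
    SimpleFunc.tendsto_approxOn_Lp_eLpNorm hHm (Set.mem_univ _) (by simp) (by simp)
      (by simpa using hH.2)
  have hcomp (i : Fin d) : Tendsto (fun n => ((hS n).eval_piLp i).toLp _) atTop
      (𝓝 ((hH.eval_piLp i).toLp _)) := by
    refine (Lp.tendsto_Lp_iff_tendsto_eLpNorm'' (fun n z => S n z i)
      (fun n => (hS n).eval_piLp i) _ (hH.eval_piLp i)).2 ?_
    refine tendsto_of_tendsto_of_tendsto_of_le_of_le tendsto_const_nhds hSt (fun _ => zero_le)
      fun n => eLpNorm_mono fun z => ?_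
    exact PiLp.norm_apply_le ((⇑(S n) - H) z) i
  have hFt : Tendsto (fun n => eLpNorm (vectorSimpleIntegral N μ (S n) - F) 2 P) atTop (𝓝 0) := by
    have hi (i : Fin d) : Tendsto (fun n => eLpNorm
        ((fun ω => vectorSimpleIntegral N μ (S n) ω i) - fun ω => F ω i) 2 P) atTop (𝓝 0) := by
      refine (Lp.tendsto_Lp_iff_tendsto_eLpNorm''
        (fun n ω => vectorSimpleIntegral N μ (S n) ω i)
        (fun n => (hN.memLp_vectorSimpleIntegral (hS n)).eval_piLp i) _ (hF.eval_piLp i)).1 ?_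
      rw [← hFW i]
      exact ((hN.wienerIto.continuous.tendsto _).comp (hcomp i)).congr fun n =>
        hN.wienerIto_eval (hS n) i
    have hs := tendsto_finsetSum Finset.univ fun i _ => hi i
    rw [Finset.sum_const_zero] at hs
    exact tendsto_of_tendsto_of_tendsto_of_le_of_le tendsto_const_nhds hs (fun _ => zero_le)
      fun n => eLpNorm_le_sum_eLpNorm_eval ((hN.memLp_vectorSimpleIntegral (hS n)).1.sub hF.1)
  -- Covariances are inner products in `L²(μ)`, which are continuous.
  have hcov (i j : Fin d) : Tendsto (fun n => ∫ z, S n z i * S n z j ∂μ) atTop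
      (𝓝 (∫ z, H z i * H z j ∂μ)) := by
    have e {X : Z → EuclideanSpace ℝ (Fin d)} (hX : MemLp X 2 μ) :
        inner ℝ ((hX.eval_piLp i).toLp _) ((hX.eval_piLp j).toLp _) = ∫ z, X z i * X z j ∂μ := by
      rw [L2.inner_def]
      refine integral_congr_ae ?_
      filter_upwards [(hX.eval_piLp i).coeFn_toLp, (hX.eval_piLp j).coeFn_toLp] with z h1 h2
      simp [h1, h2, mul_comm]
    have := (hcomp i).inner (𝕜 := ℝ) (hcomp j)
    rw [e hH] at this
    exact this.congr fun n => e (hS n)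
  have hmap {X : Ω → EuclideanSpace ℝ (Fin d)} (hX : MemLp X 2 P) :
      ∫ x, g x ∂(P.map X) = ∫ ω, g (X ω) ∂P :=
    integral_map hX.1.aemeasurable hg.continuous.aestronglyMeasurable
  have hlim := hg.tendsto_integral_comp (fun n => hN.memLp_vectorSimpleIntegral (hS n)) hF hFt
  have hlimB : Tendsto (fun n => (∑ i, ∑ j, |(∫ z, S n z i * S n z j ∂μ) - B i j|) / 2
      + 2 / 3 * ((2 * d) ^ 3 * ∫ z, ‖H z‖ ^ 3 ∂μ)) atTop
      (𝓝 ((∑ i, ∑ j, |(∫ z, H z i * H z j ∂μ) - B i j|) / 2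
        + 2 / 3 * ((2 * d) ^ 3 * ∫ z, ‖H z‖ ^ 3 ∂μ))) :=
    ((tendsto_finsetSum _ fun i _ => tendsto_finsetSum _ fun j _ =>
      ((hcov i j).sub_const (B i j)).abs).div_const 2).add_const _
  rw [hmap hF]
  refine le_of_tendsto_of_tendsto' ((hlim.sub_const _).abs) hlimB fun n => ?_
  obtain ⟨hpos, hd⟩ := hN.testDistLE_vectorSimpleIntegral (hS n)
  -- The Gaussian law with the covariance of `S n` is only an intermediate step: it is compared with
  -- the target before the limit is taken.
  have h1 := (hd.trans (testDistLE_multivariateGaussian hpos hB)) g hg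
  rw [hmap (hN.memLp_vectorSimpleIntegral (hS n))] at h1
  refine h1.trans ?_
  rw [add_comm]
  have h2 : ∫ z, (∑ i, |S n z i|) ^ 3 ∂μ ≤ (2 * d) ^ 3 * ∫ z, ‖H z‖ ^ 3 ∂μ := by
    rw [← integral_const_mul]
    refine integral_mono_of_nonneg (ae_of_all _ fun z => by positivity) (hH3.const_mul _)
      (ae_of_all _ fun z => ?_)
    dsimp only
    rw [← mul_pow]
    refine pow_le_pow_left₀ (by positivity) ?_ 3
    refine (sum_abs_le_card_mul_norm _).trans ?_
    have := mul_le_mul_of_nonneg_left (hSle n z) (Nat.cast_nonneg d)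
    linarith
  have h3 : ∀ i j, (Matrix.of fun i j => ∫ z, S n z i * S n z j ∂μ) i j
      = ∫ z, S n z i * S n z j ∂μ := fun _ _ => rfl
  simp only [h3]
  gcongr

end IsPoissonRandomMeasure

/-! ### The exponential kernel and its time average. -/

/-- The kernel `1_{(-∞, t]}(x) exp(-l (t - x))`. -/
noncomputable def expKernel (l t x : ℝ) : ℝ :=
  (Set.Iic t).indicator (fun x => Real.exp (-l * (t - x))) x

theorem ouKernel_eq (l t : ℝ) (z : ℝ × ℝ) :
    ouKernel l t z = Real.sqrt (2 * l) * (z.1 * expKernel l t z.2) := by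
  by_cases h : z.2 ≤ t
  · simp [ouKernel, expKernel, h]
    ring
  · simp [ouKernel, expKernel, h]

theorem measurable_expKernel (l : ℝ) : Measurable fun p : ℝ × ℝ => expKernel l p.1 p.2 := by
  have h : MeasurableSet {p : ℝ × ℝ | p.2 ≤ p.1} := measurableSet_le measurable_snd measurable_fst
  have : (fun p : ℝ × ℝ => expKernel l p.1 p.2)
      = {p : ℝ × ℝ | p.2 ≤ p.1}.indicator (fun p => Real.exp (-l * (p.1 - p.2))) := by
    ext p
    simp only [expKernel, Set.indicator_apply]
    rfl
  rw [this]
  exact Measurable.indicator (by fun_prop) h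

theorem measurable_ouKernel (l : ℝ) :
    Measurable fun p : ℝ × (ℝ × ℝ) => ouKernel l p.1 p.2 := by
  simp_rw [ouKernel_eq]
  have h : Measurable fun p : ℝ × (ℝ × ℝ) => expKernel l p.1 p.2.2 :=
    (measurable_expKernel l).comp (measurable_fst.prodMk measurable_snd.snd)
  fun_prop

theorem expKernel_nonneg (l t x : ℝ) : 0 ≤ expKernel l t x :=
  Set.indicator_nonneg (fun _ _ => (Real.exp_pos _).le) _

theorem expKernel_of_lt {l t x : ℝ} (h : t < x) : expKernel l t x = 0 :=
  Set.indicator_of_notMem (s := Set.Iic t) (not_le.2 h) _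

theorem expKernel_of_le {l t x : ℝ} (h : x ≤ t) : expKernel l t x = Real.exp (-l * (t - x)) :=
  Set.indicator_of_mem (s := Set.Iic t) h _

theorem indicator_Ioc_one {s t x : ℝ} (h : s < x) (h' : x ≤ t) :
    (Set.Ioc s t).indicator (fun _ => (1 : ℝ)) x = 1 :=
  Set.indicator_of_mem (s := Set.Ioc s t) ⟨h, h'⟩ _

theorem expKernel_sq (l t x : ℝ) : expKernel l t x ^ 2 = expKernel (2 * l) t x := by
  by_cases h : x ≤ t
  · simp [expKernel, h, ← Real.exp_nat_mul]
    ring_nf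
  · simp [expKernel, h]

theorem integrable_expKernel {l : ℝ} (hl : 0 < l) (t : ℝ) : Integrable (expKernel l t) := by
  have h : IntegrableOn (fun x => Real.exp (-l * (t - x))) (Set.Iic t) := by
    refine ((integrableOn_exp_mul_Iic hl t).const_mul (Real.exp (-l * t))).congr
      (ae_of_all _ fun x => ?_)
    dsimp only
    rw [← Real.exp_add]
    ring_nf
  exact h.integrable_indicator measurableSet_Iic

theorem integral_expKernel {l : ℝ} (hl : 0 < l) (t : ℝ) : ∫ x, expKernel l t x = 1 / l := by
  have h : ∀ x, expKernel l t x
      = (Set.Iic t).indicator (fun x => Real.exp (-l * t) * Real.exp (l * x)) x := fun x => by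
    simp only [expKernel, Set.indicator_apply, ← Real.exp_add]
    ring_nf
  simp_rw [h]
  rw [integral_indicator measurableSet_Iic, integral_const_mul, integral_exp_mul_Iic hl,
    mul_div_assoc', ← Real.exp_add]
  simp

theorem integrable_sub_expKernel_sq {l : ℝ} (hl : 0 < l) (s t : ℝ) :
    Integrable fun x => (expKernel l t x - expKernel l s x) ^ 2 := by
  have hm (t : ℝ) : Measurable (expKernel l t) :=
    (measurable_expKernel l).comp measurable_prodMk_left
  have h2 : 0 < 2 * l := by positivity
  refine ((integrable_expKernel h2 t).add (integrable_expKernel h2 s)).mono'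
    (((hm t).sub (hm s)).pow_const 2).aestronglyMeasurable (ae_of_all _ fun x => ?_)
  rw [Pi.add_apply, ← expKernel_sq, ← expKernel_sq, Real.norm_of_nonneg (sq_nonneg _)]
  nlinarith [mul_nonneg (expKernel_nonneg l t x) (expKernel_nonneg l s x)]

/-- On `x ≤ s` the later kernel is `q = exp(-l (t - s))` times the earlier one, and `(1 - q)² ≤ 1 -
q ≤ l (t - s)`. On `(s, t]` the square is at most `1`. The two parts contribute `(t - s) / 2` and `t
- s`. -/
theorem integral_sub_expKernel_sq_le_of_le {l : ℝ} (hl : 0 < l) {s t : ℝ} (hst : s ≤ t) :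
    ∫ x, (expKernel l t x - expKernel l s x) ^ 2 ≤ 2 * (t - s) := by
  have h2 : 0 < 2 * l := by positivity
  have hind : Integrable ((Set.Ioc s t).indicator (fun _ => (1 : ℝ))) :=
    IntegrableOn.integrable_indicator (by simp) measurableSet_Ioc
  calc ∫ x, (expKernel l t x - expKernel l s x) ^ 2
      ≤ ∫ x, ((Set.Ioc s t).indicator (fun _ => (1 : ℝ)) x
        + l * (t - s) * expKernel (2 * l) s x) := by
        refine integral_mono (integrable_sub_expKernel_sq hl s t)
          (hind.add ((integrable_expKernel h2 s).const_mul _)) fun x => ?_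
        dsimp only
        rw [← expKernel_sq]
        rcases le_or_gt x s with hx | hx
        · have e : expKernel l t x = Real.exp (-l * (t - s)) * expKernel l s x := by
            simp only [expKernel, Set.indicator_of_mem (Set.mem_Iic.2 hx),
              Set.indicator_of_mem (Set.mem_Iic.2 (hx.trans hst)), ← Real.exp_add]
            ring_nf
          rw [e, Set.indicator_of_notMem (fun h => absurd h.1 (not_lt.2 hx)), zero_add]
          have h3 : -l * (t - s) + 1 ≤ Real.exp (-l * (t - s)) := Real.add_one_le_exp _
          have h4 : Real.exp (-l * (t - s)) ≤ 1 := Real.exp_le_one_iff.2 (by nlinarith)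
          have h5 := Real.exp_pos (-l * (t - s))
          set q := Real.exp (-l * (t - s))
          have h6 : (q * expKernel l s x - expKernel l s x) ^ 2
            = (1 - q) ^ 2 * expKernel l s x ^ 2 := by ring
          rw [h6]
          refine mul_le_mul_of_nonneg_right ?_ (sq_nonneg _)
          nlinarith
        · rw [expKernel_of_lt (t := s) hx]
          by_cases hxt : x ≤ t
          · rw [indicator_Ioc_one hx hxt]
            have : expKernel l t x ≤ 1 := by
              rw [expKernel_of_le hxt]
              exact Real.exp_le_one_iff.2 (by nlinarith)
            nlinarith [expKernel_nonneg l t x]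
          · rw [expKernel_of_lt (not_le.1 hxt), Set.indicator_of_notMem (fun h => hxt h.2)]
            simp
    _ ≤ 2 * (t - s) := by
        rw [integral_add hind ((integrable_expKernel h2 s).const_mul _), integral_const_mul,
          integral_expKernel h2, integral_indicator measurableSet_Ioc]
        simp only [integral_const, MeasurableSet.univ, measureReal_restrict_apply, Set.univ_inter,
          Real.volume_real_Ioc_of_le hst, smul_eq_mul, mul_one]
        field_simp
        nlinarith

theorem integral_sub_expKernel_sq_le {l : ℝ} (hl : 0 < l) (s t : ℝ) :
    ∫ x, (expKernel l t x - expKernel l s x) ^ 2 ≤ 2 * |t - s| := by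
  rcases le_total s t with h | h
  · rw [abs_of_nonneg (sub_nonneg.2 h)]
    exact integral_sub_expKernel_sq_le_of_le hl h
  · rw [abs_sub_comm, abs_of_nonneg (sub_nonneg.2 h)]
    simp_rw [sub_sq_comm (expKernel l t _)]
    exact integral_sub_expKernel_sq_le_of_le hl h

/-- The kernel `l ∫_0^T 1_{(-∞, t]}(x) exp(-l (t - x)) dt`. -/
noncomputable def meanKernel (l T x : ℝ) : ℝ :=
  -- The integration in `t` starts at `max x 0`, and `max x 0 - x = -min x 0`.
  (Set.Iic T).indicator (fun x => Real.exp (l * min x 0) - Real.exp (-l * (T - x))) x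

theorem intervalIntegral_expKernel {l : ℝ} (hl : 0 < l) {T : ℝ} (hT : 0 ≤ T) (x : ℝ) :
    ∫ t in (0 : ℝ)..T, expKernel l t x = meanKernel l T x / l := by
  have key (a b : ℝ) : ∫ t in a..b, Real.exp (-l * (t - x))
      = (Real.exp (-l * (a - x)) - Real.exp (-l * (b - x))) / l := by
    rw [intervalIntegral.integral_comp_sub_right (fun t => Real.exp (-l * t)),
      intervalIntegral.integral_comp_mul_left (fun t => Real.exp t) (neg_ne_zero.2 hl.ne'),
      integral_exp]
    simp only [smul_eq_mul]
    field_simp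
    ring
  have hint (a b : ℝ) : IntervalIntegrable (fun t => expKernel l t x) volume a b := by
    have hm : Measurable fun t => expKernel l t x :=
      (measurable_expKernel l).comp measurable_prodMk_right
    refine (intervalIntegrable_const (c := (1 : ℝ))).mono_fun hm.aestronglyMeasurable
      (ae_of_all _ fun t => ?_)
    dsimp only
    rw [Real.norm_of_nonneg (expKernel_nonneg _ _ _)]
    by_cases h : x ≤ t
    · rw [expKernel_of_le h, norm_one]
      exact Real.exp_le_one_iff.2 (by nlinarith)
    · simp [expKernel, h]
  have hzero {a b : ℝ} (hab : a ≤ b) (hb : b ≤ x) : ∫ t in a..b, expKernel l t x = 0 := by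
    rw [intervalIntegral.integral_of_le hab]
    -- The right endpoint is dropped because the kernel equals `1`, not `0`, at `t = x`.
    rw [integral_Ioc_eq_integral_Ioo]
    refine setIntegral_eq_zero_of_forall_eq_zero fun t ht => ?_
    exact expKernel_of_lt (ht.2.trans_le hb)
  have hpos {a b : ℝ} (hab : a ≤ b) (ha : x ≤ a) : ∫ t in a..b, expKernel l t x
      = (Real.exp (-l * (a - x)) - Real.exp (-l * (b - x))) / l := by
    rw [← key]
    refine intervalIntegral.integral_congr fun t ht => ?_
    rw [Set.uIcc_of_le hab] at ht
    exact expKernel_of_le (ha.trans ht.1)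
  rcases le_or_gt x 0 with h0 | h0
  · rw [hpos hT h0, meanKernel, Set.indicator_of_mem (Set.mem_Iic.2 (h0.trans hT)),
      min_eq_left h0]
    ring_nf
  · rcases le_or_gt x T with hxT | hxT
    · rw [← intervalIntegral.integral_add_adjacent_intervals (hint 0 x) (hint x T),
        hzero h0.le le_rfl, hpos hxT le_rfl, meanKernel,
        Set.indicator_of_mem (Set.mem_Iic.2 hxT), min_eq_right h0.le]
      simp
    · rw [hzero hT hxT.le, meanKernel, Set.indicator_of_notMem (by simpa using hxT)]
      simp

theorem measurable_meanKernel (l T : ℝ) : Measurable (meanKernel l T) :=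
  Measurable.indicator (by fun_prop) measurableSet_Iic

theorem meanKernel_nonneg {l : ℝ} (hl : 0 < l) {T : ℝ} (hT : 0 ≤ T) (x : ℝ) :
    0 ≤ meanKernel l T x := by
  refine Set.indicator_nonneg (fun x hx => sub_nonneg.2 (Real.exp_le_exp.2 ?_)) x
  have hx' : x ≤ T := hx
  rw [neg_mul, ← mul_neg]
  refine mul_le_mul_of_nonneg_left (le_min ?_ ?_) hl.le <;> linarith

theorem meanKernel_le_one {l : ℝ} (hl : 0 < l) (T x : ℝ) : meanKernel l T x ≤ 1 := by
  refine Set.indicator_le' (fun x _ => ?_) (fun _ _ => zero_le_one) x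
  have h1 : Real.exp (l * min x 0) ≤ 1 :=
    Real.exp_le_one_iff.2 (mul_nonpos_of_nonneg_of_nonpos hl.le (min_le_right _ _))
  linarith [Real.exp_pos (-l * (T - x))]

/-- The averaged kernel is the indicator of `(0, T]` plus the contribution of the past before time
`0` minus the part not yet discharged at time `T`. The two corrections have equal integrals, so the
total integral is exactly `T`. -/
theorem meanKernel_eq_sum {l : ℝ} {T : ℝ} (hT : 0 ≤ T) (x : ℝ) :
    meanKernel l T x = (Set.Ioc 0 T).indicator (fun _ => (1 : ℝ)) x + expKernel l 0 x
      - expKernel l T x := by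
  rcases le_or_gt x 0 with h0 | h0
  · rw [meanKernel, expKernel, expKernel, Set.indicator_of_mem (Set.mem_Iic.2 (h0.trans hT)),
      Set.indicator_of_mem (Set.mem_Iic.2 h0), Set.indicator_of_mem (Set.mem_Iic.2 (h0.trans hT)),
      Set.indicator_of_notMem (fun h => absurd h.1 (not_lt.2 h0)), min_eq_left h0]
    ring_nf
  · rw [expKernel_of_lt h0]
    rcases le_or_gt x T with hx | hx
    · rw [meanKernel, expKernel_of_le hx, Set.indicator_of_mem (Set.mem_Iic.2 hx),
        indicator_Ioc_one h0 hx, min_eq_right h0.le]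
      simp
    · rw [meanKernel, expKernel_of_lt hx, Set.indicator_of_notMem (by simpa using hx),
        Set.indicator_of_notMem (fun h => absurd h.2 (not_le.2 hx))]
      simp

theorem integrable_indicator_Ioc (T : ℝ) :
    Integrable ((Set.Ioc 0 T).indicator (fun _ => (1 : ℝ))) :=
  IntegrableOn.integrable_indicator (by simp) measurableSet_Ioc

theorem integral_indicator_Ioc {T : ℝ} (hT : 0 ≤ T) :
    ∫ x, (Set.Ioc 0 T).indicator (fun _ => (1 : ℝ)) x = T := by
  rw [integral_indicator measurableSet_Ioc]
  simp [Real.volume_real_Ioc_of_le hT]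

theorem integrable_meanKernel {l : ℝ} (hl : 0 < l) {T : ℝ} (hT : 0 ≤ T) :
    Integrable (meanKernel l T) := by
  rw [funext (meanKernel_eq_sum (l := l) hT)]
  exact ((integrable_indicator_Ioc T).add (integrable_expKernel hl 0)).sub
    (integrable_expKernel hl T)

theorem integral_meanKernel {l : ℝ} (hl : 0 < l) {T : ℝ} (hT : 0 ≤ T) :
    ∫ x, meanKernel l T x = T := by
  simp_rw [meanKernel_eq_sum (l := l) hT]
  have h1 : Integrable (fun x => (Set.Ioc 0 T).indicator (fun _ => (1 : ℝ)) x + expKernel l 0 x) :=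
    (integrable_indicator_Ioc T).add (integrable_expKernel hl 0)
  rw [integral_sub h1 (integrable_expKernel hl T),
    integral_add (integrable_indicator_Ioc T) (integrable_expKernel hl 0),
    integral_expKernel hl, integral_expKernel hl, integral_indicator_Ioc hT]
  ring

theorem integrable_meanKernel_mul {l l' : ℝ} (hl : 0 < l) (hl' : 0 < l') {T : ℝ} (hT : 0 ≤ T) :
    Integrable fun x => meanKernel l T x * meanKernel l' T x := by
  refine (integrable_meanKernel hl hT).mono'
    ((measurable_meanKernel l T).mul (measurable_meanKernel l' T)).aestronglyMeasurable
    (ae_of_all _ fun x => ?_)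
  rw [Real.norm_of_nonneg (mul_nonneg (meanKernel_nonneg hl hT x) (meanKernel_nonneg hl' hT x))]
  exact mul_le_of_le_one_right (meanKernel_nonneg hl hT x) (meanKernel_le_one hl' T x)

theorem integral_meanKernel_mul_le {l l' : ℝ} (hl : 0 < l) (hl' : 0 < l') {T : ℝ} (hT : 0 ≤ T) :
    ∫ x, meanKernel l T x * meanKernel l' T x ≤ T := by
  refine le_of_le_of_eq ?_ (integral_meanKernel hl hT)
  exact integral_mono (integrable_meanKernel_mul hl hl' hT) (integrable_meanKernel hl hT)
    fun x => mul_le_of_le_one_right (meanKernel_nonneg hl hT x) (meanKernel_le_one hl' T x)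

/-- On `(0, T]` this is `(1 - a)(1 - b) ≥ 1 - a - b` for the exponential tails `a, b ≥ 0`. Elsewhere
the lower bound is nonpositive and the product is nonnegative. -/
theorem le_integral_meanKernel_mul {l l' : ℝ} (hl : 0 < l) (hl' : 0 < l') {T : ℝ} (hT : 0 ≤ T) :
    T - 1 / l - 1 / l' ≤ ∫ x, meanKernel l T x * meanKernel l' T x := by
  have h1 : Integrable (fun x => (Set.Ioc 0 T).indicator (fun _ => (1 : ℝ)) x - expKernel l T x) :=
    (integrable_indicator_Ioc T).sub (integrable_expKernel hl T)
  have e : T - 1 / l - 1 / l' = ∫ x, ((Set.Ioc 0 T).indicator (fun _ => (1 : ℝ)) x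
      - expKernel l T x - expKernel l' T x) := by
    rw [integral_sub h1 (integrable_expKernel hl' T),
      integral_sub (integrable_indicator_Ioc T) (integrable_expKernel hl T),
      integral_expKernel hl, integral_expKernel hl', integral_indicator_Ioc hT]
  rw [e]
  refine integral_mono (h1.sub (integrable_expKernel hl' T))
    (integrable_meanKernel_mul hl hl' hT) fun x => ?_
  dsimp only
  have n1 := meanKernel_nonneg hl hT x
  have n2 := meanKernel_nonneg hl' hT x
  have p1 := expKernel_nonneg l T x
  have p2 := expKernel_nonneg l' T x
  by_cases hx : x ∈ Set.Ioc 0 T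
  · rw [meanKernel_eq_sum hT, meanKernel_eq_sum hT, expKernel_of_lt hx.1, expKernel_of_lt hx.1,
      Set.indicator_of_mem hx]
    nlinarith
  · rw [Set.indicator_of_notMem hx]
    nlinarith [mul_nonneg n1 n2]

theorem abs_integral_meanKernel_mul_sub_le {l l' : ℝ} (hl : 0 < l) (hl' : 0 < l') {T : ℝ}
    (hT : 0 < T) : |(∫ x, meanKernel l T x * meanKernel l' T x) / T - 1|
      ≤ (1 + 1 / l + 1 / l') / Real.sqrt T := by
  set q := ∫ x, meanKernel l T x * meanKernel l' T x with hq
  have h1 : q ≤ T := integral_meanKernel_mul_le hl hl' hT.le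
  have h2 : T - 1 / l - 1 / l' ≤ q := le_integral_meanKernel_mul hl hl' hT.le
  have h0 : 0 ≤ q := integral_nonneg fun x =>
    mul_nonneg (meanKernel_nonneg hl hT.le x) (meanKernel_nonneg hl' hT.le x)
  have hs : 0 < Real.sqrt T := Real.sqrt_pos.2 hT
  have hss : Real.sqrt T * Real.sqrt T = T := Real.mul_self_sqrt hT.le
  have hl1 : 0 < 1 / l := by positivity
  have hl2 : 0 < 1 / l' := by positivity
  have e : |q / T - 1| = (T - q) / T := by
    rw [abs_of_nonpos (by rw [sub_nonpos, div_le_one hT]; exact h1)]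
    field_simp
    ring
  rw [e, div_le_div_iff₀ hT hs]
  -- For `T ≥ 1` the error `O(1 / T)` is below `O(1 / √T)`. For `T ≤ 1` the error is at most `1 ≤ 1
  -- / √T`, which explains the summand `1` in the constant.
  rcases le_total 1 (Real.sqrt T) with h | h
  · have hT1 : Real.sqrt T ≤ T := by nlinarith
    nlinarith
  · nlinarith [mul_le_mul_of_nonneg_left h hT.le, mul_nonneg h0 hs.le,
      mul_pos hl1 hT, mul_pos hl2 hT]

/-! ### Square integrals of the Ornstein–Uhlenbeck kernel. -/

theorem memLp_two_prod_mul {ν : Measure ℝ} [SFinite ν] (hν2 : Integrable (fun u : ℝ => u ^ 2) ν)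
    {k : ℝ → ℝ} (hk : Measurable k) (hk2 : Integrable fun x => k x ^ 2) :
    MemLp (fun z : ℝ × ℝ => z.1 * k z.2) 2 (ν.prod volume) := by
  have hm : Measurable fun z : ℝ × ℝ => z.1 * k z.2 := by fun_prop
  rw [memLp_two_iff_integrable_sq hm.aestronglyMeasurable]
  simp_rw [mul_pow]
  exact hν2.mul_prod hk2

theorem memLp_ouKernel {ν : Measure ℝ} [SFinite ν] (hν2 : Integrable (fun u : ℝ => u ^ 2) ν)
    {l : ℝ} (hl : 0 < l) (t : ℝ) : MemLp (ouKernel l t) 2 (ν.prod volume) := by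
  rw [funext (ouKernel_eq l t)]
  refine (memLp_two_prod_mul hν2 ((measurable_expKernel l).comp measurable_prodMk_left) ?_).const_mul
    (Real.sqrt (2 * l))
  simp only [Function.comp_def, expKernel_sq]
  exact integrable_expKernel (by positivity) t

theorem integral_ouKernel_sq {ν : Measure ℝ} [SFinite ν] (hν : ∫ u, u ^ 2 ∂ν = 1)
    {l : ℝ} (hl : 0 < l) (t : ℝ) : ∫ z, ouKernel l t z ^ 2 ∂(ν.prod volume) = 1 := by
  simp_rw [ouKernel_eq, mul_pow, expKernel_sq]
  rw [integral_const_mul, integral_prod_mul (fun u : ℝ => u ^ 2) (expKernel (2 * l) t), hν,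
    integral_expKernel (by positivity), Real.sq_sqrt (by positivity)]
  field_simp

theorem integral_sub_ouKernel_sq_le {ν : Measure ℝ} [SFinite ν] (hν : ∫ u, u ^ 2 ∂ν = 1)
    {l : ℝ} (hl : 0 < l) (s t : ℝ) :
    ∫ z, (ouKernel l t z - ouKernel l s z) ^ 2 ∂(ν.prod volume) ≤ 4 * l * |t - s| := by
  simp_rw [ouKernel_eq, ← mul_sub, mul_pow]
  rw [integral_const_mul, integral_prod_mul (fun u : ℝ => u ^ 2)
    (fun x => (expKernel l t x - expKernel l s x) ^ 2), hν, Real.sq_sqrt (by positivity), one_mul]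
  have := integral_sub_expKernel_sq_le hl s t
  nlinarith

theorem Lp.norm_toLp_sq {α : Type*} [MeasurableSpace α] {m : Measure α} {f : α → ℝ}
    (hf : MemLp f 2 m) : ‖hf.toLp f‖ ^ 2 = ∫ a, f a ^ 2 ∂m := by
  rw [← real_inner_self_eq_norm_sq, L2.inner_def]
  refine integral_congr_ae ?_
  filter_upwards [hf.coeFn_toLp] with a h
  simp [h, sq]

/-! ### Exchanging the Wiener–Itô integral and the time integral. -/

section Fubini

variable {α : Type*} [MeasurableSpace α] {m : Measure α} [SFinite m] {H : ℝ → α → ℝ} {T K : ℝ}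

theorem integrable_prod_sq (hH : Measurable (Function.uncurry H))
    (h2 : ∀ t ∈ Set.Ioc 0 T, MemLp (H t) 2 m) (hK : ∀ t ∈ Set.Ioc 0 T, ∫ a, H t a ^ 2 ∂m ≤ K) :
    Integrable (fun p : ℝ × α => H p.1 p.2 ^ 2) ((volume.restrict (Set.Ioc 0 T)).prod m) := by
  have hm : Measurable fun p : ℝ × α => H p.1 p.2 ^ 2 := by
    have : Measurable fun p : ℝ × α => H p.1 p.2 := hH
    fun_prop
  rw [integrable_prod_iff hm.aestronglyMeasurable]
  constructor
  · filter_upwards [ae_restrict_mem measurableSet_Ioc] with t ht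
    exact (memLp_two_iff_integrable_sq (h2 t ht).1).1 (h2 t ht)
  · refine (integrable_const K).mono' (hm.aestronglyMeasurable.norm.integral_prod_right') ?_
    filter_upwards [ae_restrict_mem measurableSet_Ioc] with t ht
    rw [Real.norm_of_nonneg (integral_nonneg fun _ => norm_nonneg _)]
    simpa using hK t ht

theorem ae_integrableOn_of_memLp_two (hH : Measurable (Function.uncurry H))
    (h2 : ∀ t ∈ Set.Ioc 0 T, MemLp (H t) 2 m) (hK : ∀ t ∈ Set.Ioc 0 T, ∫ a, H t a ^ 2 ∂m ≤ K) :
    ∀ᵐ a ∂m, IntegrableOn (fun t => H t a) (Set.Ioc 0 T) ∧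
      IntegrableOn (fun t => H t a ^ 2) (Set.Ioc 0 T) := by
  filter_upwards [(integrable_prod_sq hH h2 hK).prod_left_ae] with a ha
  have hm : Measurable fun t => H t a := hH.comp measurable_prodMk_right
  exact ⟨((memLp_two_iff_integrable_sq hm.aestronglyMeasurable).2 ha).integrable one_le_two, ha⟩

theorem sq_setIntegral_le {f : ℝ → ℝ} (hT : 0 < T) (hf : IntegrableOn f (Set.Ioc 0 T))
    (hf2 : IntegrableOn (fun t => f t ^ 2) (Set.Ioc 0 T)) :
    (∫ t in Set.Ioc 0 T, f t) ^ 2 ≤ T * ∫ t in Set.Ioc 0 T, f t ^ 2 := by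
  set c := (∫ t in Set.Ioc 0 T, f t) with hc
  -- The Cauchy–Schwarz inequality is obtained by expanding the variance `∫ (f - c / T)² ≥ 0`, with
  -- `c / T` the mean of `f`.
  have h1 : 0 ≤ ∫ t in Set.Ioc 0 T, (f t ^ 2 - (2 * (c / T)) * f t + (c / T) ^ 2) :=
    integral_nonneg fun t => by
      change (0 : ℝ) ≤ f t ^ 2 - (2 * (c / T)) * f t + (c / T) ^ 2
      nlinarith [sq_nonneg (f t - c / T)]
  have h2 : IntegrableOn (fun t => f t ^ 2 - (2 * (c / T)) * f t) (Set.Ioc 0 T) :=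
    hf2.sub (hf.const_mul _)
  rw [integral_add h2 (integrable_const _), integral_sub hf2 (hf.const_mul _),
    integral_const_mul, ← hc] at h1
  simp only [integral_const, MeasurableSet.univ, measureReal_restrict_apply, Set.univ_inter,
    Real.volume_real_Ioc_of_le hT.le, smul_eq_mul, sub_zero] at h1
  have h3 : (c / T) * T = c := by field_simp
  have h4 : T * (2 * (c / T) * c) = 2 * c ^ 2 := by field_simp
  have h5 : T * (T * (c / T) ^ 2) = c ^ 2 := by field_simp
  nlinarith [mul_nonneg hT.le h1]

theorem memLp_intervalIntegral (hT : 0 < T) (hH : Measurable (Function.uncurry H))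
    (h2 : ∀ t ∈ Set.Ioc 0 T, MemLp (H t) 2 m) (hK : ∀ t ∈ Set.Ioc 0 T, ∫ a, H t a ^ 2 ∂m ≤ K) :
    MemLp (fun a => ∫ t in (0 : ℝ)..T, H t a) 2 m := by
  simp_rw [intervalIntegral.integral_of_le hT.le]
  have hm : StronglyMeasurable fun a => ∫ t in Set.Ioc 0 T, H t a :=
    hH.stronglyMeasurable.integral_prod_left'
  rw [memLp_two_iff_integrable_sq hm.aestronglyMeasurable]
  refine ((integrable_prod_sq hH h2 hK).integral_prod_right.const_mul T).mono'
    (hm.aestronglyMeasurable.pow 2) ?_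
  filter_upwards [ae_integrableOn_of_memLp_two hH h2 hK] with a ha
  rw [Real.norm_of_nonneg (sq_nonneg _)]
  exact sq_setIntegral_le hT ha.1 ha.2

theorem integral_mul_intervalIntegral (hT : 0 < T) (hH : Measurable (Function.uncurry H))
    (h2 : ∀ t ∈ Set.Ioc 0 T, MemLp (H t) 2 m) (hK : ∀ t ∈ Set.Ioc 0 T, ∫ a, H t a ^ 2 ∂m ≤ K)
    {X : α → ℝ} (hX : MemLp X 2 m) :
    ∫ a, X a * (∫ t in (0 : ℝ)..T, H t a) ∂m = ∫ t in (0 : ℝ)..T, ∫ a, X a * H t a ∂m := by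
  simp_rw [intervalIntegral.integral_of_le hT.le, ← integral_const_mul]
  refine integral_integral_swap ?_
  have hi : Integrable (fun p : α × ℝ => H p.2 p.1 ^ 2)
      (m.prod (volume.restrict (Set.Ioc 0 T))) := (integrable_prod_sq hH h2 hK).swap
  have hX2 : Integrable (fun p : α × ℝ => X p.1 ^ 2) (m.prod (volume.restrict (Set.Ioc 0 T))) := by
    simpa using ((memLp_two_iff_integrable_sq hX.1).1 hX).mul_prod
      (integrable_const (μ := volume.restrict (Set.Ioc 0 T)) (1 : ℝ))
  have hHm : Measurable fun p : α × ℝ => H p.2 p.1 := hH.comp measurable_swap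
  refine (hX2.add hi).mono' (hX.1.comp_fst.mul hHm.aestronglyMeasurable) (ae_of_all _ fun p => ?_)
  change ‖X p.1 * H p.2 p.1‖ ≤ X p.1 ^ 2 + H p.2 p.1 ^ 2
  rw [Real.norm_eq_abs, abs_mul]
  nlinarith [sq_nonneg (|X p.1| - |H p.2 p.1|), sq_abs (X p.1), sq_abs (H p.2 p.1),
    abs_nonneg (X p.1), abs_nonneg (H p.2 p.1), mul_nonneg (abs_nonneg (X p.1))
      (abs_nonneg (H p.2 p.1))]

end Fubini

theorem inner_toLp_eq_integral {α : Type*} [MeasurableSpace α] {m : Measure α} (X : Lp ℝ 2 m)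
    {f : α → ℝ} (hf : MemLp f 2 m) : inner ℝ X (hf.toLp f) = ∫ a, X a * f a ∂m := by
  rw [L2.inner_def]
  refine integral_congr_ae ?_
  filter_upwards [hf.coeFn_toLp] with a h
  simp [h, mul_comm]

/-- The Wiener-Itô integral commutes with integration in a parameter. -/
theorem IsPoissonRandomMeasure.wienerIto_intervalIntegral {Ω Z : Type*} [MeasurableSpace Ω]
    [MeasurableSpace Z] {N : Ω → Measure Z} {μ : Measure Z} [SFinite μ] {P : Measure Ω}
    [IsProbabilityMeasure P] (hN : IsPoissonRandomMeasure N μ P) {f : ℝ → Z → ℝ} {Y : ℝ → Ω → ℝ}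
    {T K K' : ℝ} (hT : 0 < T) (hf : Measurable (Function.uncurry f))
    (hf2 : ∀ t ∈ Set.Ioc 0 T, MemLp (f t) 2 μ)
    (hfK : ∀ t ∈ Set.Ioc 0 T, ∫ z, f t z ^ 2 ∂μ ≤ K) (hY : Measurable (Function.uncurry Y))
    (hY2 : ∀ t ∈ Set.Ioc 0 T, MemLp (Y t) 2 P)
    (hYK : ∀ t ∈ Set.Ioc 0 T, ∫ ω, Y t ω ^ 2 ∂P ≤ K')
    (h : ∀ (t : ℝ) (ht : t ∈ Set.Ioc 0 T),
      hN.wienerIto ((hf2 t ht).toLp _) = (hY2 t ht).toLp _) :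
    hN.wienerIto ((memLp_intervalIntegral hT hf hf2 hfK).toLp _)
      = (memLp_intervalIntegral hT hY hY2 hYK).toLp _ := by
  -- Testing against `X` and moving `wienerIto` to its adjoint reduces the claim to scalar Fubini on
  -- both sides, so no vector valued integral is needed.
  refine ext_inner_left ℝ fun X => ?_
  rw [← ContinuousLinearMap.adjoint_inner_left, inner_toLp_eq_integral, inner_toLp_eq_integral,
    integral_mul_intervalIntegral hT hf hf2 hfK (Lp.memLp _),
    integral_mul_intervalIntegral hT hY hY2 hYK (Lp.memLp _),
    intervalIntegral.integral_of_le hT.le, intervalIntegral.integral_of_le hT.le]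
  refine setIntegral_congr_fun measurableSet_Ioc fun t ht => ?_
  rw [← inner_toLp_eq_integral _ (hf2 t ht), ← inner_toLp_eq_integral _ (hY2 t ht), ← h t ht,
    ContinuousLinearMap.adjoint_inner_left]

/-! ### Existence of measurable Ornstein–Uhlenbeck processes. -/

/-- A process whose increments are `1/2`-Hölder continuous in `L¹` has a jointly measurable
version. -/
theorem exists_measurable_version {Ω : Type*} [MeasurableSpace Ω] {P : Measure Ω}
    {y : ℝ → Ω → ℝ} (hy : ∀ t, Measurable (y t)) {C : ℝ}
    (h : ∀ s t, eLpNorm (y t - y s) 1 P ≤ ENNReal.ofReal (C * Real.sqrt |t - s|)) :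
    ∃ Y : ℝ → Ω → ℝ, Measurable (Function.uncurry Y) ∧ ∀ t, Y t =ᵐ[P] y t := by
  -- On the grid of mesh `4^{-n}` the Hölder exponent `1/2` makes the errors at most a constant
  -- times `2^{-n}`, hence summable.
  set τ : ℕ → ℝ → ℝ := fun n t => (⌊(4 : ℝ) ^ n * t⌋ : ℝ) / 4 ^ n with hτ
  have hdist (n : ℕ) (t : ℝ) : Real.sqrt |τ n t - t| ≤ (1 / 2) ^ n := by
    have h4 : (0 : ℝ) < 4 ^ n := by positivity
    have e : τ n t - t = (⌊(4 : ℝ) ^ n * t⌋ - 4 ^ n * t) / 4 ^ n := by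
      rw [hτ]
      field_simp
    have h1 := Int.floor_le ((4 : ℝ) ^ n * t)
    have h2 := Int.lt_floor_add_one ((4 : ℝ) ^ n * t)
    rw [e, abs_div, abs_of_pos h4]
    refine Real.sqrt_le_iff.2 ⟨by positivity, ?_⟩
    have e2 : (((1 : ℝ) / 2) ^ n) ^ 2 = 1 / 4 ^ n := by
      rw [← pow_mul, mul_comm, pow_mul, ← one_div_pow]
      norm_num
    rw [e2]
    refine div_le_div_of_nonneg_right ?_ h4.le
    rw [abs_le]
    constructor <;> linarith
  -- Each approximation takes countably many time values and is therefore jointly measurable;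
  -- `limsup` keeps this everywhere, even where the sequence does not converge. For each `t`,
  -- summability of the `L¹` errors makes the limit equal `y t` almost surely.
  refine ⟨fun t ω => limsup (fun n => y (τ n t) ω) atTop, ?_, fun t => ?_⟩
  · refine Measurable.limsup fun n => ?_
    have h1 : Measurable fun p : ℤ × Ω => y ((p.1 : ℝ) / 4 ^ n) p.2 :=
      measurable_from_prod_countable_right fun k => hy ((k : ℝ) / 4 ^ n)
    have h2 : Measurable fun p : ℝ × Ω => ((⌊(4 : ℝ) ^ n * p.1⌋ : ℤ), p.2) :=
      (Int.measurable_floor.comp (measurable_fst.const_mul _)).prodMk measurable_snd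
    exact h1.comp h2
  · have hsum : ∑' n, eLpNorm (y (τ n t) - y t) 1 P ≠ ∞ := by
      have hC : Summable fun n : ℕ => |C| * (1 / 2) ^ n :=
        (summable_geometric_of_lt_one (by norm_num) (by norm_num)).mul_left _
      refine ne_top_of_le_ne_top hC.tsum_ofReal_ne_top (ENNReal.tsum_le_tsum fun n => ?_)
      refine (h t (τ n t)).trans (ENNReal.ofReal_le_ofReal ?_)
      exact mul_le_mul (le_abs_self C) (hdist n t) (Real.sqrt_nonneg _) (abs_nonneg C)
    have hm (n : ℕ) : Measurable fun ω => ‖y (τ n t) ω - y t ω‖ₑ :=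
      ((hy _).sub (hy _)).enorm
    have hint : ∫⁻ ω, ∑' n, ‖y (τ n t) ω - y t ω‖ₑ ∂P ≠ ∞ := by
      rw [lintegral_tsum fun n => (hm n).aemeasurable]
      simpa only [eLpNorm_one_eq_lintegral_enorm, Pi.sub_apply] using hsum
    filter_upwards [ae_lt_top (Measurable.tsum hm) hint] with ω hω
    have h0 := ENNReal.tendsto_atTop_zero_of_tsum_ne_top hω.ne
    have h1 : Tendsto (fun n => y (τ n t) ω) atTop (𝓝 (y t ω)) := by
      rw [tendsto_iff_edist_tendsto_0]
      simpa only [edist_eq_enorm_sub] using h0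
    exact h1.limsup_eq

/-- The contraction property transfers the `L²` estimate of kernel differences to the increments,
which are thus `1/2`-Hölder in `L²(P)` and so in `L¹(P)`. -/
theorem exists_isOULevyProcess {Ω : Type*} [MeasurableSpace Ω] {P : Measure Ω}
    [IsProbabilityMeasure P] {ν : Measure ℝ} [SigmaFinite ν]
    (hν2 : Integrable (fun u : ℝ => u ^ 2) ν) (hν : ∫ u, u ^ 2 ∂ν = 1)
    {N : Ω → Measure (ℝ × ℝ)} (hN : IsPoissonRandomMeasure N (ν.prod volume) P)
    {l : ℝ} (hl : 0 < l) : ∃ Y : ℝ → Ω → ℝ, IsOULevyProcess N ν P l Y := by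
  set w : ℝ → Lp ℝ 2 P := fun t => hN.wienerIto ((memLp_ouKernel hν2 hl t).toLp _) with hw
  have hdist (s t : ℝ) : ‖w t - w s‖ ≤ Real.sqrt (4 * l) * Real.sqrt |t - s| := by
    rw [hw]
    dsimp only
    rw [← map_sub, ← MemLp.toLp_sub]
    refine (hN.norm_wienerIto_le _).trans ?_
    rw [← Real.sqrt_mul (by positivity)]
    refine Real.le_sqrt_of_sq_le ?_
    rw [Lp.norm_toLp_sq]
    exact integral_sub_ouKernel_sq_le hν hl s t
  obtain ⟨Y, hY, hYw⟩ := exists_measurable_version (P := P) (y := fun t => ⇑(w t))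
    (C := Real.sqrt (4 * l))
    (fun t => (Lp.stronglyMeasurable _).measurable) fun s t => by
      have h1 : ⇑(w t) - ⇑(w s) =ᵐ[P] ⇑(w t - w s) := (Lp.coeFn_sub _ _).symm
      rw [eLpNorm_congr_ae h1]
      refine (eLpNorm_le_eLpNorm_of_exponent_le one_le_two
        (Lp.aestronglyMeasurable (w t - w s))).trans ?_
      rw [← Lp.enorm_def, ← ofReal_norm]
      exact ENNReal.ofReal_le_ofReal (hdist s t)
  refine ⟨Y, hY, fun t _ => ?_⟩
  have hF : MemLp (Y t) 2 P := (Lp.memLp (w t)).ae_eq (hYw t).symm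
  rw [hN.isWienerItoIntegral_iff (memLp_ouKernel hν2 hl t) hF]
  change w t = _
  rw [← Lp.toLp_coeFn (w t) (Lp.memLp _), MemLp.toLp_eq_toLp_iff]
  exact (hYw t).symm

/-! ### From test functions to characteristic functions and `d₃`. -/

theorem abs_cos_taylor_two_remainder_le (a s : ℝ) :
    |Real.cos (a + s) - Real.cos a - -(Real.sin a * s) - -(Real.cos a * s ^ 2) / 2|
      ≤ |s| ^ 3 / 6 := by
  have hd (k : ℕ) (t : ℝ) : iteratedDeriv k (fun r : ℝ => Real.cos (a + r • s)) t
      = s ^ k * iteratedDeriv k Real.cos (a + t • s) := by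
    rw [iteratedDeriv_comp_line Real.contDiff_cos a s k le_rfl,
      iteratedFDeriv_apply_eq_iteratedDeriv_mul_prod]
    simp
  have h := abs_taylor_two_remainder_le (φ := fun r : ℝ => Real.cos (a + r • s)) (M := |s| ^ 3)
    (Real.contDiff_cos.comp (by fun_prop)) fun t => by
      rw [hd, abs_mul, abs_pow]
      refine mul_le_of_le_one_right (by positivity) ?_
      simpa [iteratedDeriv_succ] using Real.abs_sin_le_one _
  rw [hd, hd] at h
  simp only [one_smul, zero_smul, add_zero, Real.deriv_cos, iteratedDeriv_succ,
    iteratedDeriv_zero, Real.deriv_cos', deriv.fun_neg, Real.deriv_sin, pow_one] at h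
  refine le_of_eq_of_le ?_ h
  congr 1
  ring

/-- The divisor `(1 + ‖ξ‖) ^ 3` dominates `‖ξ‖`, `‖ξ‖²` and `‖ξ‖³`, the sizes of the Lipschitz
constant, the second derivatives and the Taylor remainder. -/
theorem isTestFunction_cos {d : ℕ} (ξ : EuclideanSpace ℝ (Fin d)) (θ : ℝ) :
    IsTestFunction fun x => Real.cos (inner ℝ ξ x + θ) / (1 + ‖ξ‖) ^ 3 := by
  have hK1 : 1 ≤ 1 + ‖ξ‖ := by linarith [norm_nonneg ξ]
  have hK : 0 < (1 + ‖ξ‖) ^ 3 := by positivity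
  have hξ (i : Fin d) : |ξ i| ≤ ‖ξ‖ := PiLp.norm_apply_le ξ i
  have hinner (v : EuclideanSpace ℝ (Fin d)) : inner ℝ ξ v = ∑ i, ξ i * v i := by
    simp [PiLp.inner_apply, mul_comm]
  constructor
  · intro x
    set a := inner ℝ ξ x + θ with ha
    refine ⟨(-(Real.sin a) / (1 + ‖ξ‖) ^ 3) • innerSL ℝ ξ,
      fun i j => -(Real.cos a * (ξ i * ξ j)) / (1 + ‖ξ‖) ^ 3, fun i j => ?_, fun v => ?_⟩
    · rw [abs_div, abs_neg, abs_mul, abs_mul, abs_of_pos hK, div_le_one hK]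
      calc |Real.cos a| * (|ξ i| * |ξ j|) ≤ 1 * (‖ξ‖ * ‖ξ‖) := by
            gcongr
            · exact Real.abs_cos_le_one a
            · exact hξ i
            · exact hξ j
        _ ≤ (1 + ‖ξ‖) ^ 3 := by nlinarith [norm_nonneg ξ, pow_nonneg (norm_nonneg ξ) 3]
    · have h := abs_cos_taylor_two_remainder_le a (inner ℝ ξ v)
      have hsq : ∑ i, ∑ j, -(Real.cos a * (ξ i * ξ j)) / (1 + ‖ξ‖) ^ 3 * (v i * v j)
          = -(Real.cos a * inner ℝ ξ v ^ 2) / (1 + ‖ξ‖) ^ 3 := by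
        rw [hinner, sq, Finset.sum_mul_sum, Finset.mul_sum, ← Finset.sum_neg_distrib,
          Finset.sum_div]
        refine Finset.sum_congr rfl fun i _ => ?_
        rw [Finset.mul_sum, ← Finset.sum_neg_distrib, Finset.sum_div]
        exact Finset.sum_congr rfl fun j _ => by ring
      have hs : |inner ℝ ξ v| ≤ (1 + ‖ξ‖) * ∑ i, |v i| := by
        rw [hinner, Finset.mul_sum]
        refine (Finset.abs_sum_le_sum_abs _ _).trans (Finset.sum_le_sum fun i _ => ?_)
        rw [abs_mul]
        exact mul_le_mul_of_nonneg_right ((hξ i).trans (by linarith)) (abs_nonneg _)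
      have e : Real.cos (inner ℝ ξ (x + v) + θ) = Real.cos (a + inner ℝ ξ v) := by
        rw [inner_add_right, ha]
        ring_nf
      rw [hsq, e]
      have e2 : Real.cos (a + inner ℝ ξ v) / (1 + ‖ξ‖) ^ 3 - Real.cos a / (1 + ‖ξ‖) ^ 3
          - ((-(Real.sin a) / (1 + ‖ξ‖) ^ 3) • innerSL ℝ ξ) v
          - -(Real.cos a * inner ℝ ξ v ^ 2) / (1 + ‖ξ‖) ^ 3 / 2
          = (Real.cos (a + inner ℝ ξ v) - Real.cos a - -(Real.sin a * inner ℝ ξ v)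
            - -(Real.cos a * inner ℝ ξ v ^ 2) / 2) / (1 + ‖ξ‖) ^ 3 := by
        simp only [smul_apply, innerSL_apply_apply, smul_eq_mul]
        ring
      rw [e2, abs_div, abs_of_pos hK, div_le_iff₀ hK]
      refine h.trans ?_
      have := pow_le_pow_left₀ (abs_nonneg _) hs 3
      rw [mul_pow] at this
      linarith
  · refine ⟨1, zero_le_one, fun x y => ?_⟩
    rw [← sub_div, abs_div, abs_of_pos hK, div_le_iff₀ hK]
    have h1 : |Real.cos (inner ℝ ξ x + θ) - Real.cos (inner ℝ ξ y + θ)| ≤ ‖ξ‖ * ‖x - y‖ := by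
      refine (Real.abs_cos_sub_cos_le _ _).trans ?_
      rw [add_sub_add_right_eq_sub, ← inner_sub_right]
      exact abs_real_inner_le_norm _ _
    refine h1.trans ?_
    have h2 : ‖ξ‖ ≤ (1 + ‖ξ‖) ^ 3 := by
      nlinarith [norm_nonneg ξ, pow_nonneg (norm_nonneg ξ) 3, pow_nonneg (norm_nonneg ξ) 2]
    calc ‖ξ‖ * ‖x - y‖ ≤ (1 + ‖ξ‖) ^ 3 * ‖x - y‖ := by gcongr
      _ = 1 * 1 * ‖x - y‖ * (1 + ‖ξ‖) ^ 3 := by ring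
      _ ≤ 1 * (1 + ‖x‖ + ‖y‖) * ‖x - y‖ * (1 + ‖ξ‖) ^ 3 := by
        gcongr
        linarith [norm_nonneg x, norm_nonneg y]

theorem charFun_eq_cos_add {d : ℕ} (P : Measure (EuclideanSpace ℝ (Fin d)))
    [IsProbabilityMeasure P] (ξ : EuclideanSpace ℝ (Fin d)) :
    charFun P ξ = ((∫ x, Real.cos (inner ℝ ξ x) ∂P : ℝ) : ℂ)
      + ((∫ x, Real.sin (inner ℝ ξ x) ∂P : ℝ) : ℂ) * Complex.I := by
  have hc : Integrable (fun x => Real.cos (inner ℝ ξ x)) P :=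
    .of_bound (by fun_prop) 1 (ae_of_all _ fun x => by simpa using Real.abs_cos_le_one _)
  have hs : Integrable (fun x => Real.sin (inner ℝ ξ x)) P :=
    .of_bound (by fun_prop) 1 (ae_of_all _ fun x => by simpa using Real.abs_sin_le_one _)
  rw [charFun_apply, ← integral_complex_ofReal, ← integral_complex_ofReal, ← integral_mul_const,
    ← integral_add hc.ofReal (hs.ofReal.mul_const _)]
  refine integral_congr_ae (ae_of_all _ fun x => ?_)
  dsimp only
  rw [real_inner_comm, Complex.exp_mul_I]
  push_cast
  rfl

theorem TestDistLE.norm_charFun_sub_le {d : ℕ} {P Q : Measure (EuclideanSpace ℝ (Fin d))}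
    [IsProbabilityMeasure P] [IsProbabilityMeasure Q] {c : ℝ} (h : TestDistLE P Q c)
    (ξ : EuclideanSpace ℝ (Fin d)) :
    ‖charFun P ξ - charFun Q ξ‖ ≤ 2 * ((1 + ‖ξ‖) ^ 3 * c) := by
  have hK : 0 < (1 + ‖ξ‖) ^ 3 := by positivity
  have key (θ : ℝ) : |(∫ x, Real.cos (inner ℝ ξ x + θ) ∂P) - ∫ x, Real.cos (inner ℝ ξ x + θ) ∂Q|
      ≤ (1 + ‖ξ‖) ^ 3 * c := by
    have := h _ (isTestFunction_cos ξ θ)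
    rw [integral_div, integral_div, ← sub_div, abs_div, abs_of_pos hK, div_le_iff₀ hK] at this
    linarith
  have h1 := key 0
  -- This phase turns the cosine into the sine, which gives the imaginary part.
  have h2 := key (-(Real.pi / 2))
  simp only [add_zero] at h1
  simp only [← sub_eq_add_neg, Real.cos_sub_pi_div_two] at h2
  rw [charFun_eq_cos_add, charFun_eq_cos_add]
  set a := ∫ x, Real.cos (inner ℝ ξ x) ∂P
  set b := ∫ x, Real.sin (inner ℝ ξ x) ∂P
  set a' := ∫ x, Real.cos (inner ℝ ξ x) ∂Q
  set b' := ∫ x, Real.sin (inner ℝ ξ x) ∂Q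
  have e : ((a : ℂ) + b * Complex.I) - (a' + b' * Complex.I)
      = ((a - a' : ℝ) : ℂ) + ((b - b' : ℝ) : ℂ) * Complex.I := by
    push_cast
    ring
  rw [e]
  refine (norm_add_le _ _).trans ?_
  rw [norm_mul, Complex.norm_I, mul_one, Complex.norm_real, Complex.norm_real, Real.norm_eq_abs,
    Real.norm_eq_abs]
  linarith

theorem dist3_le_of_testDistLE {d : ℕ} {P Q : Measure (EuclideanSpace ℝ (Fin d))} {c : ℝ}
    (h : TestDistLE P Q c) : dist3 P Q ≤ ENNReal.ofReal c :=
  iSup_le fun g => iSup_le fun hg => iSup_le fun h2 => iSup_le fun h3 =>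
    ENNReal.ofReal_le_ofReal (h g (isTestFunction_of_derivSupNorm_le hg h2 h3))

theorem tendstoInDistribution_of_testDistLE {d : ℕ} {Ω Ω' : Type*} [MeasurableSpace Ω]
    [MeasurableSpace Ω'] {P : Measure Ω} [IsProbabilityMeasure P] {P' : Measure Ω'}
    [IsProbabilityMeasure P'] {F : ℝ → Ω → EuclideanSpace ℝ (Fin d)}
    {X : Ω' → EuclideanSpace ℝ (Fin d)} (hF : ∀ T, Measurable (F T))
    {Q : Measure (EuclideanSpace ℝ (Fin d))} (hX : HasLaw X Q P') {c : ℝ → ℝ}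
    (h : ∀ T, 0 < T → TestDistLE (P.map (F T)) Q (c T)) (hc : Tendsto c atTop (𝓝 0)) :
    TendstoInDistribution F atTop X (fun _ => P) P' := by
  refine ⟨fun T => (hF T).aemeasurable, hX.aemeasurable, ?_⟩
  have hPT (T : ℝ) : IsProbabilityMeasure (P.map (F T)) :=
    Measure.isProbabilityMeasure_map (hF T).aemeasurable
  have hQ : IsProbabilityMeasure Q := by
    rw [← hX.map_eq]
    exact Measure.isProbabilityMeasure_map hX.aemeasurable
  -- Lévy's continuity theorem is applied along sequences `u n → ∞`.
  refine tendsto_of_seq_tendsto fun u hu => ?_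
  refine ProbabilityMeasure.tendsto_of_tendsto_charFun fun ξ => ?_
  rw [tendsto_iff_norm_sub_tendsto_zero]
  have hb : Tendsto (fun n => 2 * ((1 + ‖ξ‖) ^ 3 * c (u n))) atTop (𝓝 0) := by
    simpa using ((hc.comp hu).const_mul ((1 + ‖ξ‖) ^ 3)).const_mul 2
  refine squeeze_zero' (Eventually.of_forall fun _ => norm_nonneg _) ?_ hb
  filter_upwards [hu.eventually_gt_atTop 0] with n hn
  have := (h (u n) hn).norm_charFun_sub_le ξ
  change ‖charFun (P.map (F (u n))) ξ - charFun (P'.map X) ξ‖ ≤ _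
  rwa [hX.map_eq]

/-! ### The limit covariance and the averaged kernel. -/

/-- The limit covariance has rank at most one: after averaging, every coordinate sees asymptotically
the same kernel `u 1_{(0, T]}(x)`, up to the factor `√(2 l i) / l i`. Positive semidefiniteness
follows. -/
theorem limitCov_eq {d : ℕ} (l : Fin d → ℝ) (hl : ∀ i, 0 < l i) (i j : Fin d) :
    limitCov l i j = (Real.sqrt (2 * l i) / l i) * (Real.sqrt (2 * l j) / l j) := by
  have h1 := hl i
  have h2 := hl j
  rw [limitCov, Matrix.of_apply, Real.sqrt_mul h1.le, Real.sqrt_mul zero_le_two,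
    Real.sqrt_mul zero_le_two]
  have e1 := Real.mul_self_sqrt h1.le
  have e2 := Real.mul_self_sqrt h2.le
  have e0 := Real.mul_self_sqrt (zero_le_two (α := ℝ))
  have p1 := Real.sqrt_pos.2 h1
  have p2 := Real.sqrt_pos.2 h2
  rw [div_mul_div_comm, div_eq_div_iff (by positivity) (by positivity)]
  calc 2 * (l i * l j) = (Real.sqrt 2 * Real.sqrt 2) * ((Real.sqrt (l i) * Real.sqrt (l i))
        * (Real.sqrt (l j) * Real.sqrt (l j))) := by rw [e0, e1, e2]
    _ = _ := by ring

theorem posSemidef_limitCov {d : ℕ} (l : Fin d → ℝ) (hl : ∀ i, 0 < l i) :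
    (limitCov l).PosSemidef := by
  have e : limitCov l = (1 : ℝ) • Matrix.vecMulVec (fun i => Real.sqrt (2 * l i) / l i)
      (fun i => Real.sqrt (2 * l i) / l i) := by
    ext i j
    rw [limitCov_eq l hl, Matrix.smul_apply, Matrix.vecMulVec_apply, one_smul]
  rw [e]
  exact posSemidef_smul_vecMulVec _ zero_le_one

/-- The vector of the averaged kernels, whose Wiener-Itô integral is the empirical mean. -/
noncomputable def averagedKernel {d : ℕ} (l : Fin d → ℝ) (T : ℝ) (z : ℝ × ℝ) :
    EuclideanSpace ℝ (Fin d) :=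
  WithLp.toLp 2 (fun i => (1 / Real.sqrt T) * ∫ t in (0 : ℝ)..T, ouKernel (l i) t z)

section AveragedKernel

variable {d : ℕ} {l : Fin d → ℝ} {T : ℝ}

theorem averagedKernel_apply (hl : ∀ i, 0 < l i) (hT : 0 < T) (z : ℝ × ℝ) (i : Fin d) :
    averagedKernel l T z i
      = (1 / Real.sqrt T * (Real.sqrt (2 * l i) / l i)) * (z.1 * meanKernel (l i) T z.2) := by
  change (1 / Real.sqrt T) * (∫ t in (0 : ℝ)..T, ouKernel (l i) t z) = _
  simp_rw [ouKernel_eq]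
  rw [intervalIntegral.integral_const_mul, intervalIntegral.integral_const_mul,
    intervalIntegral_expKernel (hl i) hT.le]
  ring

theorem measurable_averagedKernel (hl : ∀ i, 0 < l i) (hT : 0 < T) :
    Measurable (averagedKernel l T) := by
  have h : averagedKernel l T = fun z => WithLp.toLp 2 fun i =>
      (1 / Real.sqrt T * (Real.sqrt (2 * l i) / l i)) * (z.1 * meanKernel (l i) T z.2) := by
    ext z i
    exact averagedKernel_apply hl hT z i
  have hm (i : Fin d) : Measurable fun z : ℝ × ℝ => meanKernel (l i) T z.2 :=
    (measurable_meanKernel (l i) T).comp measurable_snd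
  rw [h]
  fun_prop

variable {ν : Measure ℝ}

theorem integrable_cube_bound (hν3 : Integrable (fun u : ℝ => u ^ 3) ν) (hl : ∀ i, 0 < l i)
    (hT : 0 < T) : Integrable (fun z : ℝ × ℝ => |z.1 ^ 3| *
      ∑ i, Real.sqrt (2 * l i) / l i * meanKernel (l i) T z.2) (ν.prod volume) :=
  hν3.abs.mul_prod (g := fun x => ∑ i, Real.sqrt (2 * l i) / l i * meanKernel (l i) T x)
    (integrable_finsetSum _ fun i _ => (integrable_meanKernel (hl i) hT.le).const_mul _)

/-- Of the three kernel factors, two are bounded by constants and one is kept: its integral in `x`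
is of order `T`, which against `T^{-3/2}` gives `T^{-1/2}`. -/
theorem norm_averagedKernel_cube_le (hl : ∀ i, 0 < l i) (hT : 0 < T) (z : ℝ × ℝ) :
    ‖averagedKernel l T z‖ ^ 3 ≤ ((1 / Real.sqrt T) ^ 3 * (∑ i, Real.sqrt (2 * l i) / l i) ^ 2)
      * (|z.1 ^ 3| * ∑ i, Real.sqrt (2 * l i) / l i * meanKernel (l i) T z.2) := by
  have ha (i : Fin d) : 0 ≤ Real.sqrt (2 * l i) / l i := div_nonneg (Real.sqrt_nonneg _) (hl i).le
  set c := ∑ i, Real.sqrt (2 * l i) / l i with hc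
  set q := ∑ i, Real.sqrt (2 * l i) / l i * meanKernel (l i) T z.2 with hq
  have hq0 : 0 ≤ q :=
    Finset.sum_nonneg fun i _ => mul_nonneg (ha i) (meanKernel_nonneg (hl i) hT.le _)
  have hqc : q ≤ c :=
    Finset.sum_le_sum fun i _ => mul_le_of_le_one_right (ha i) (meanKernel_le_one (hl i) _ _)
  have h1 : ‖averagedKernel l T z‖ ≤ 1 / Real.sqrt T * (|z.1| * q) := by
    conv_lhs => rw [EuclideanSpace.eq_sum_smul_single (averagedKernel l T z)]
    refine (norm_sum_le _ _).trans (le_of_eq ?_)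
    rw [hq, Finset.mul_sum, Finset.mul_sum]
    refine Finset.sum_congr rfl fun i _ => ?_
    rw [norm_smul, PiLp.norm_single, norm_one, mul_one, averagedKernel_apply hl hT,
      Real.norm_eq_abs, abs_mul, abs_mul, abs_mul,
      abs_of_nonneg (meanKernel_nonneg (hl i) hT.le _), abs_of_nonneg (ha i),
      abs_of_nonneg (by positivity : 0 ≤ 1 / Real.sqrt T)]
    ring
  calc ‖averagedKernel l T z‖ ^ 3 ≤ (1 / Real.sqrt T * (|z.1| * q)) ^ 3 :=
        pow_le_pow_left₀ (norm_nonneg _) h1 3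
    _ = ((1 / Real.sqrt T) ^ 3 * |z.1| ^ 3 * q) * q ^ 2 := by ring
    _ ≤ ((1 / Real.sqrt T) ^ 3 * |z.1| ^ 3 * q) * c ^ 2 :=
        mul_le_mul_of_nonneg_left (pow_le_pow_left₀ hq0 hqc 2) (by positivity)
    _ = _ := by rw [abs_pow]; ring

theorem integrable_averagedKernel_cube (hν3 : Integrable (fun u : ℝ => u ^ 3) ν)
    (hl : ∀ i, 0 < l i) (hT : 0 < T) :
    Integrable (fun z => ‖averagedKernel l T z‖ ^ 3) (ν.prod volume) := by
  refine ((integrable_cube_bound hν3 hl hT).const_mul ((1 / Real.sqrt T) ^ 3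
    * (∑ i, Real.sqrt (2 * l i) / l i) ^ 2)).mono'
    ((measurable_averagedKernel hl hT).norm.pow_const 3).aestronglyMeasurable
    (ae_of_all _ fun z => ?_)
  rw [Real.norm_of_nonneg (by positivity)]
  exact norm_averagedKernel_cube_le hl hT z

variable [SFinite ν]

theorem integral_averagedKernel_mul (hν : ∫ u, u ^ 2 ∂ν = 1) (hl : ∀ i, 0 < l i) (hT : 0 < T)
    (i j : Fin d) :
    ∫ z, averagedKernel l T z i * averagedKernel l T z j ∂(ν.prod volume)
      = limitCov l i j * ((∫ x, meanKernel (l i) T x * meanKernel (l j) T x) / T) := by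
  have e (z : ℝ × ℝ) : averagedKernel l T z i * averagedKernel l T z j
      = (limitCov l i j / T) * (z.1 ^ 2 * (meanKernel (l i) T z.2 * meanKernel (l j) T z.2)) := by
    have hs : 1 / Real.sqrt T * (1 / Real.sqrt T) = 1 / T := by
      rw [div_mul_div_comm, Real.mul_self_sqrt hT.le, one_mul]
    rw [averagedKernel_apply hl hT, averagedKernel_apply hl hT, limitCov_eq l hl,
      div_eq_mul_one_div _ T, ← hs]
    ring
  simp_rw [e]
  rw [integral_const_mul, integral_prod_mul (fun u : ℝ => u ^ 2)
    (fun x => meanKernel (l i) T x * meanKernel (l j) T x), hν]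
  ring

theorem integral_averagedKernel_cube_le (hν3 : Integrable (fun u : ℝ => u ^ 3) ν)
    (hl : ∀ i, 0 < l i) (hT : 0 < T) :
    ∫ z, ‖averagedKernel l T z‖ ^ 3 ∂(ν.prod volume)
      ≤ (∑ i, Real.sqrt (2 * l i) / l i) ^ 3 * (∫ u, |u ^ 3| ∂ν) / Real.sqrt T := by
  refine (integral_mono (integrable_averagedKernel_cube hν3 hl hT)
    ((integrable_cube_bound hν3 hl hT).const_mul _)
    (norm_averagedKernel_cube_le hl hT)).trans (le_of_eq ?_)
  rw [integral_const_mul, integral_prod_mul (fun u : ℝ => |u ^ 3|)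
    (fun x => ∑ i, Real.sqrt (2 * l i) / l i * meanKernel (l i) T x),
    integral_finsetSum _ fun i _ => (integrable_meanKernel (hl i) hT.le).const_mul _]
  simp_rw [integral_const_mul, fun i => integral_meanKernel (hl i) hT.le]
  rw [← Finset.sum_mul]
  have hs := Real.sqrt_pos.2 hT
  have hss : Real.sqrt T ^ 2 = T := Real.sq_sqrt hT.le
  conv_lhs => rw [← hss]
  rw [Real.sqrt_sq hs.le]
  field_simp

end AveragedKernel

/-! ### The empirical means. -/

section EmpiricalMean

variable {d : ℕ} {l : Fin d → ℝ} {T : ℝ} {ν : Measure ℝ} {Ω : Type*}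
  [MeasurableSpace Ω] {P : Measure Ω} {N : Ω → Measure (ℝ × ℝ)}
  {Y : Fin d → ℝ → Ω → ℝ}

theorem IsOULevyProcess.memLp {l : ℝ} {Y : ℝ → Ω → ℝ} (hY : IsOULevyProcess N ν P l Y) {t : ℝ}
    (ht : 0 ≤ t) : MemLp (Y t) 2 P := (hY.isIntegral t ht).2.1

theorem measurable_empiricalMean (hY : ∀ i, IsOULevyProcess N ν P (l i) (Y i)) (T : ℝ) :
    Measurable (empiricalMean Y T) := by
  have h (i : Fin d) : Measurable fun ω => ∫ t in (0 : ℝ)..T, Y i t ω := by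
    simp only [intervalIntegral]
    exact ((hY i).measurable.stronglyMeasurable.integral_prod_left'.sub
      (hY i).measurable.stronglyMeasurable.integral_prod_left').measurable
  unfold empiricalMean
  fun_prop

variable [SigmaFinite ν]

theorem IsOULevyProcess.wienerIto_eq {l : ℝ} {Y : ℝ → Ω → ℝ} (hY : IsOULevyProcess N ν P l Y)
    (hN : IsPoissonRandomMeasure N (ν.prod volume) P)
    (hν2 : Integrable (fun u : ℝ => u ^ 2) ν) (hl : 0 < l) {t : ℝ} (ht : 0 ≤ t) :
    hN.wienerIto ((memLp_ouKernel hν2 hl t).toLp _) = (hY.memLp ht).toLp _ :=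
  (hN.isWienerItoIntegral_iff _ _).1 (hY.isIntegral t ht)

theorem IsOULevyProcess.integral_sq_le {l : ℝ} {Y : ℝ → Ω → ℝ} (hY : IsOULevyProcess N ν P l Y)
    (hN : IsPoissonRandomMeasure N (ν.prod volume) P)
    (hν2 : Integrable (fun u : ℝ => u ^ 2) ν) (hν : ∫ u, u ^ 2 ∂ν = 1) (hl : 0 < l) {t : ℝ}
    (ht : 0 ≤ t) : ∫ ω, Y t ω ^ 2 ∂P ≤ 1 := by
  rw [← Lp.norm_toLp_sq (hY.memLp ht), ← hY.wienerIto_eq hN hν2 hl ht,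
    ← integral_ouKernel_sq (ν := ν) hν hl t, ← Lp.norm_toLp_sq (memLp_ouKernel hν2 hl t)]
  exact pow_le_pow_left₀ (norm_nonneg _) (hN.norm_wienerIto_le _) 2

variable [IsProbabilityMeasure P]

theorem IsOULevyProcess.ae_intervalIntegrable {l : ℝ} {Y : ℝ → Ω → ℝ}
    (hY : IsOULevyProcess N ν P l Y) (hN : IsPoissonRandomMeasure N (ν.prod volume) P)
    (hν2 : Integrable (fun u : ℝ => u ^ 2) ν) (hν : ∫ u, u ^ 2 ∂ν = 1) (hl : 0 < l)
    (hT : 0 < T) : ∀ᵐ ω ∂P, IntervalIntegrable (fun t => Y t ω) volume 0 T := by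
  filter_upwards [ae_integrableOn_of_memLp_two (T := T) hY.measurable
    (fun t ht => hY.memLp ht.1.le) fun t ht => hY.integral_sq_le hN hν2 hν hl ht.1.le] with ω h
  rw [intervalIntegrable_iff_integrableOn_Ioc_of_le hT.le]
  exact h.1

/-- Both integrability proofs are bundled with the identity because the `L²` classes depend on them;
`c` is later `1 / √T`. -/
theorem IsOULevyProcess.wienerIto_mean {l : ℝ} {Y : ℝ → Ω → ℝ}
    (hY : IsOULevyProcess N ν P l Y) (hN : IsPoissonRandomMeasure N (ν.prod volume) P)
    (hν2 : Integrable (fun u : ℝ => u ^ 2) ν) (hν : ∫ u, u ^ 2 ∂ν = 1) (hl : 0 < l)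
    (hT : 0 < T) (c : ℝ) :
    ∃ (h : MemLp (fun z => c * ∫ t in (0 : ℝ)..T, ouKernel l t z) 2 (ν.prod volume))
      (h' : MemLp (fun ω => c * ∫ t in (0 : ℝ)..T, Y t ω) 2 P),
      hN.wienerIto (h.toLp _) = h'.toLp _ := by
  have hk : Measurable (Function.uncurry (ouKernel l)) := measurable_ouKernel l
  have h1 := memLp_intervalIntegral hT hk (fun t _ => memLp_ouKernel hν2 hl t)
    fun t _ => (integral_ouKernel_sq hν hl t).le
  have h2 := memLp_intervalIntegral hT hY.measurable (fun t ht => hY.memLp ht.1.le)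
    fun t ht => hY.integral_sq_le hN hν2 hν hl ht.1.le
  have h3 := hN.wienerIto_intervalIntegral hT hk (fun t _ => memLp_ouKernel hν2 hl t)
    (fun t _ => (integral_ouKernel_sq hν hl t).le) hY.measurable (fun t ht => hY.memLp ht.1.le)
    (fun t ht => hY.integral_sq_le hN hν2 hν hl ht.1.le)
    fun t ht => hY.wienerIto_eq hN hν2 hl ht.1.le
  refine ⟨h1.const_mul c, h2.const_mul c, ?_⟩
  have e1 : (h1.const_mul c).toLp _ = c • h1.toLp _ := MemLp.toLp_const_smul c h1
  have e2 : (h2.const_mul c).toLp _ = c • h2.toLp _ := MemLp.toLp_const_smul c h2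
  rw [e1, e2, map_smul, h3]

theorem memLp_empiricalMean (hY : ∀ i, IsOULevyProcess N ν P (l i) (Y i))
    (hN : IsPoissonRandomMeasure N (ν.prod volume) P)
    (hν2 : Integrable (fun u : ℝ => u ^ 2) ν) (hν : ∫ u, u ^ 2 ∂ν = 1) (hl : ∀ i, 0 < l i)
    (hT : 0 < T) : MemLp (empiricalMean Y T) 2 P :=
  MemLp.of_eval_piLp fun i =>
    ((hY i).wienerIto_mean hN hν2 hν (hl i) hT (1 / Real.sqrt T)).choose_spec.choose

theorem testDistLE_empiricalMean (hY : ∀ i, IsOULevyProcess N ν P (l i) (Y i))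
    (hN : IsPoissonRandomMeasure N (ν.prod volume) P)
    (hν2 : Integrable (fun u : ℝ => u ^ 2) ν) (hν3 : Integrable (fun u : ℝ => u ^ 3) ν)
    (hν : ∫ u, u ^ 2 ∂ν = 1) (hl : ∀ i, 0 < l i) (hT : 0 < T) :
    TestDistLE (P.map (empiricalMean Y T)) (multivariateGaussian 0 (limitCov l))
      (((∑ i, ∑ j, limitCov l i j * (1 + 1 / l i + 1 / l j)) / 2
        + 2 / 3 * ((2 * d) ^ 3 * ((∑ i, Real.sqrt (2 * l i) / l i) ^ 3 * ∫ u, |u ^ 3| ∂ν)))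
        / Real.sqrt T) := by
  have hH : MemLp (averagedKernel l T) 2 (ν.prod volume) := MemLp.of_eval_piLp fun i =>
    ((hY i).wienerIto_mean hN hν2 hν (hl i) hT (1 / Real.sqrt T)).choose
  have h := hN.testDistLE_of_wienerIto (measurable_averagedKernel hl hT) hH
    (integrable_averagedKernel_cube hν3 hl hT) (memLp_empiricalMean hY hN hν2 hν hl hT)
    (fun i => ((hY i).wienerIto_mean hN hν2 hν (hl i) hT
      (1 / Real.sqrt T)).choose_spec.choose_spec) (posSemidef_limitCov l hl)
  intro g hg
  -- Covariance error and third moment are both of order `1 / √T`; their constants add up to the one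
  -- claimed.
  refine (h g hg).trans ?_
  have hcov (i j : Fin d) : |(∫ z, averagedKernel l T z i * averagedKernel l T z j
      ∂(ν.prod volume)) - limitCov l i j|
      ≤ limitCov l i j * (1 + 1 / l i + 1 / l j) / Real.sqrt T := by
    have hB : 0 ≤ limitCov l i j := div_nonneg zero_le_two (Real.sqrt_nonneg _)
    rw [integral_averagedKernel_mul hν hl hT, ← mul_sub_one, abs_mul, abs_of_nonneg hB,
      mul_div_assoc]
    exact mul_le_mul_of_nonneg_left (abs_integral_meanKernel_mul_sub_le (hl i) (hl j) hT) hB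
  have h1 : ∑ i, ∑ j, |(∫ z, averagedKernel l T z i * averagedKernel l T z j
      ∂(ν.prod volume)) - limitCov l i j|
      ≤ (∑ i, ∑ j, limitCov l i j * (1 + 1 / l i + 1 / l j)) / Real.sqrt T := by
    simp_rw [Finset.sum_div]
    exact Finset.sum_le_sum fun i _ => Finset.sum_le_sum fun j _ => hcov i j
  have h2 := mul_le_mul_of_nonneg_left (integral_averagedKernel_cube_le hν3 hl hT)
    (by positivity : (0 : ℝ) ≤ (2 * d) ^ 3)
  rw [add_div, mul_div_assoc, mul_div_assoc, div_right_comm]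
  gcongr

end EmpiricalMean

/-! ### The limit theorem and its rate. -/

theorem mainTheorem9 {d : ℕ} (l : Fin d → ℝ) (hl : ∀ i, 0 < l i)
    (ν : Measure ℝ) [SigmaFinite ν] [NullSingletonClass ν]
    (hν2 : Integrable (fun u : ℝ => u ^ 2) ν) (hν3 : Integrable (fun u : ℝ => u ^ 3) ν)
    (hν4 : Integrable (fun u : ℝ => u ^ 4) ν) (hν6 : Integrable (fun u : ℝ => u ^ 6) ν)
    (hν : ∫ u, u ^ 2 ∂ν = 1) :
    ∃ α : ℝ, 0 < α ∧
      ∀ (Ω : Type*) [MeasurableSpace Ω] (P : Measure Ω) [IsProbabilityMeasure P]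
        (N : Ω → Measure (ℝ × ℝ)), IsPoissonRandomMeasure N (ν.prod volume) P →
        -- the processes exist
        (∀ i, ∃ Y : ℝ → Ω → ℝ, IsOULevyProcess N ν P (l i) Y) ∧
        ∀ Y : Fin d → ℝ → Ω → ℝ, (∀ i, IsOULevyProcess N ν P (l i) (Y i)) →
          -- the empirical means are well defined and have finite second moments
          (∀ T : ℝ, 0 < T →
            (∀ i, ∀ᵐ ω ∂P, IntervalIntegrable (fun t => Y i t ω) volume 0 T) ∧
            MemLp (empiricalMean Y T) 2 P) ∧
          -- convergence in law to every Gaussian vector `X` with law `N(0, B)`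
          (∀ (Ω' : Type*) [MeasurableSpace Ω'] (P' : Measure Ω') [IsProbabilityMeasure P']
            (X : Ω' → EuclideanSpace ℝ (Fin d)),
            HasLaw X (multivariateGaussian 0 (limitCov l)) P' →
            TendstoInDistribution (fun T : ℝ => empiricalMean Y T) atTop X (fun _ => P) P') ∧
          (limitCov l).PosSemidef ∧
          -- rate of convergence
          ∀ T : ℝ, 0 < T →
            dist3 (P.map (empiricalMean Y T)) (multivariateGaussian 0 (limitCov l)) ≤
              ENNReal.ofReal (α / Real.sqrt T) := by
  set α := (∑ i, ∑ j, limitCov l i j * (1 + 1 / l i + 1 / l j)) / 2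
    + 2 / 3 * ((2 * d) ^ 3 * ((∑ i, Real.sqrt (2 * l i) / l i) ^ 3 * ∫ u, |u ^ 3| ∂ν)) with hα
  have hα0 : 0 ≤ α := by
    have h1 : 0 ≤ ∑ i, ∑ j, limitCov l i j * (1 + 1 / l i + 1 / l j) :=
      Finset.sum_nonneg fun i _ => Finset.sum_nonneg fun j _ => by
        have hi := hl i
        have hj := hl j
        exact mul_nonneg (div_nonneg zero_le_two (Real.sqrt_nonneg _)) (by positivity)
    have h2 : 0 ≤ ∑ i, Real.sqrt (2 * l i) / l i :=
      Finset.sum_nonneg fun i _ => div_nonneg (Real.sqrt_nonneg _) (hl i).le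
    have h3 : 0 ≤ ∫ u, |u ^ 3| ∂ν := integral_nonneg fun _ => abs_nonneg _
    positivity
  -- The constant must be strictly positive, whereas the explicit one vanishes for `d = 0`.
  refine ⟨α + 1, by linarith, ?_⟩
  intro Ω _ P _ N hN
  refine ⟨fun i => exists_isOULevyProcess hν2 hν hN (hl i), fun Y hY => ?_⟩
  have hd (T : ℝ) (hT : 0 < T) := testDistLE_empiricalMean hY hN hν2 hν3 hν hl hT
  refine ⟨fun T hT => ⟨fun i => (hY i).ae_intervalIntegrable hN hν2 hν (hl i) hT,
    memLp_empiricalMean hY hN hν2 hν hl hT⟩, fun Ω' _ P' _ X hX => ?_,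
    posSemidef_limitCov l hl, fun T hT => ?_⟩
  · exact tendstoInDistribution_of_testDistLE (measurable_empiricalMean hY) hX hd
      (Real.tendsto_sqrt_atTop.const_div_atTop α)
  · refine (dist3_le_of_testDistLE (hd T hT)).trans (ENNReal.ofReal_le_ofReal ?_)
    exact div_le_div_of_nonneg_right (le_add_of_nonneg_right zero_le_one) (Real.sqrt_nonneg T)
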